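/- Let $n,m,d,\delta\ge 0$ be integers and let $q\in(-\infty,1)$ be real. Let $g_1,\dots,g_m\in\mathbb R[x]=\mathbb R[x_1,\dots,x_n]$, let $d_j=\deg g_j$ and $v_j=\lceil d_j/2\rceil$, and let $\mathcal X=\{x\in\mathbb R^n: g_j(x)\ge 0,\ j=1,\dots,m\}$. Assume that one of the $g_j$ is $R^2-\sum_{i=1}^n x_i^2$ for some real $R$ (so that $\mathcal X$ is compact) and that $\mathcal X$ has nonempty interior. *Notation.* Let $\mathbf v_k(x)=(x^\alpha)_{|\alpha|\le k}$. For $\mathbf y=(y_\alpha)_{|\alpha|\le 2k}$ let $L_{\mathbf y}(f)=\sum_\alpha f_\alpha y_\alpha$ for polynomials $f=\sum_\alpha f_\alpha x^\alpha$ of degree at most $2k$, let $M_k(\mathbf y)=(y_{\alpha+\beta})_{|\alpha|,|\beta|\le k}$, and let $M_{k-v_j}(g_j\mathbf y)=(L_{\mathbf y}(g_j x^{\alpha}x^{\beta}))_{|\alpha|,|\beta|\le k-v_j}$. Let $\Sigma[x]_{2k}$ be the set of finite sums of squares of polynomials of degree at most $k$. Put $$\mathcal M^{\mathsf{SDP}}_{2(d+\delta)}(\mathcal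 X)=\Big\{(y_\alpha)_{|\alpha|\le 2d}:\ \exists\,\mathbf z=(z_\alpha)_{|\alpha|\le 2(d+\delta)},\ z_\alpha=y_\alpha\ (|\alpha|\le 2d),\ M_{d+\delta}(\mathbf z)\succeq 0,\ M_{d+\delta-v_j}(g_j\mathbf z)\succeq 0,\ j=1,\dots,m\Big\},$$ $$\mathcal P^{\mathsf{SOS}}_{2(d+\delta)}(\mathcal X)=\Big\{h=\sigma_0+\sum_{j=1}^m g_j\sigma_j:\ \deg h\le 2d,\ \sigma_0\in\Sigma[x]_{2(d+\delta)},\ \sigma_j\in\Sigma[x]_{2(d+\delta-v_j)}\Big\},$$ where the condition on $M_{d+\delta-v_j}(g_j\mathbf z)$ and the term $g_j\sigma_j$ are omitted for those $j$ with $v_j>d+\delta$. For a positive semidefinite real $p\times p$ matrix $M$ let $\phi_q(M)=(\frac1p\operatorname{trace}(M^q))^{1/q}$ if $0<q<1$ or if $q<0$ and $M$ is positive definite, $\phi_0(M)=\det(M)^{1/p}$ if $M$ is positive definite, and $\phi_q(M)=0$ if $q\le 0$ and $M$ is singular. If $M_d(\mathbf y)$ is positive definite, let $$p_{\mathbf y}(x)=\operatorname{trace}(M_d(\mathbf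 y)^q)-\mathbf v_d(x)^\top M_d(\mathbf y)^{q-1}\mathbf v_d(x).$$ *Theorem.* Consider the problem of maximizing $\phi_q(M_d(\mathbf y))$ subject to $\mathbf y\in\mathcal M^{\mathsf{SDP}}_{2(d+\delta)}(\mathcal X)$ and $y_0=1$. a) The problem has a unique optimal solution $\mathbf y^\star$. b) The matrix $M_d(\mathbf y^\star)$ is positive definite, and the polynomial $p^\star=p_{\mathbf y^\star}$ lies in $\mathcal P^{\mathsf{SOS}}_{2(d+\delta)}(\mathcal X)$, is nonnegative on $\mathcal X$, and satisfies $L_{\mathbf y^\star}(p^\star)=0$. c) For every $\mathbf y=(y_\alpha)_{|\alpha|\le 2d}$ the following are equivalent: (i) $\mathbf y$ is the unique optimal solution of the problem; (ii) $\mathbf y\in\mathcal M^{\mathsf{SDP}}_{2(d+\delta)}(\mathcal X)$, $y_0=1$, $M_d(\mathbf y)$ is positive definite and $p_{\mathbf y}\in\mathcal P^{\mathsf{SOS}}_{2(d+\delta)}(\mathcal X)$. -/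

import Mathlib

open scoped Matrix

noncomputable section

namespace OptDesign

/-- Multi-indices `α ∈ ℕⁿ` with `|α| ≤ k`; there are `s(k) = (n + k).choose n` of them. -/
abbrev MultiIndex (n k : ℕ) : Type := {α : Fin n →₀ ℕ // α.degree ≤ k}

instance instFintypeMultiIndex (n k : ℕ) : Fintype (MultiIndex n k) :=
  (Finsupp.finite_of_degree_le (σ := Fin n) k).fintype

/-- The closed basic semi-algebraic set `{x ∈ ℝⁿ : g_j(x) ≥ 0 for all j}`. -/
def semialgebraicSet {n m : ℕ} (g : Fin m → MvPolynomial (Fin n) ℝ) : Set (Fin n → ℝ) :=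
  {x | ∀ j, 0 ≤ MvPolynomial.eval x (g j)}

/-- Half the degree of `g`, rounded up: `⌈deg g / 2⌉`. -/
def halfDegree {n : ℕ} (g : MvPolynomial (Fin n) ℝ) : ℕ := (g.totalDegree + 1) / 2

/-- The linear functional `L_y(f) = ∑_α f_α y_α` of a truncated sequence `y = (y_α)_{|α| ≤ k}`;
it is applied to polynomials `f` of degree at most `k`. -/
def rieszFunctional {n k : ℕ} (y : MultiIndex n k → ℝ) (f : MvPolynomial (Fin n) ℝ) : ℝ :=
  ∑ α : MultiIndex n k, f.coeff α.1 * y α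

/-- The moment matrix `M_k(y) = (y_{α+β})_{|α|,|β| ≤ k}` of `y = (y_α)_{|α| ≤ 2k}`. -/
def momentMatrix {n k : ℕ} (y : MultiIndex n (2 * k) → ℝ) :
    Matrix (MultiIndex n k) (MultiIndex n k) ℝ :=
  Matrix.of fun α β => y ⟨α.1 + β.1, by
    have hα := α.2
    have hβ := β.2
    rw [map_add]
    omega⟩

/-- The localizing matrix `M_l(f y) = (L_y(f x^α x^β))_{|α|,|β| ≤ l}`, for `deg f + 2 l ≤ k`
or, more generally, as long as only moments of order at most `k` occur. -/
def localizingMatrix {n k : ℕ} (l : ℕ) (f : MvPolynomial (Fin n) ℝ) (y : MultiIndex n k → ℝ) :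
    Matrix (MultiIndex n l) (MultiIndex n l) ℝ :=
  Matrix.of fun α β =>
    rieszFunctional y (f * (MvPolynomial.monomial α.1 1 * MvPolynomial.monomial β.1 1))

/-- The relaxed moment cone `M^{SDP}_{2(d+δ)}(X)`: the sequences `(y_α)_{|α| ≤ 2d}` that extend to a
sequence `z = (z_α)_{|α| ≤ 2(d+δ)}` with `M_{d+δ}(z) ⪰ 0` and `M_{d+δ-v_j}(g_j z) ⪰ 0`, where
`v_j = ⌈deg g_j / 2⌉`. A localizing matrix of negative order is empty and imposes nothing. -/
def relaxedMomentCone {n m : ℕ} (g : Fin m → MvPolynomial (Fin n) ℝ) (d δ : ℕ) :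
    Set (MultiIndex n (2 * d) → ℝ) :=
  {y | ∃ z : MultiIndex n (2 * (d + δ)) → ℝ,
    (∀ α : MultiIndex n (2 * d), y α = z ⟨α.1, by have hα := α.2; omega⟩) ∧
    (momentMatrix z).PosSemidef ∧
    ∀ j, halfDegree (g j) ≤ d + δ →
      (localizingMatrix (d + δ - halfDegree (g j)) (g j) z).PosSemidef}

/-- The feasible set of the relaxation: `y ∈ M^{SDP}_{2(d+δ)}(X)` and `y_0 = 1`. -/
def feasibleSet {n m : ℕ} (g : Fin m → MvPolynomial (Fin n) ℝ) (d δ : ℕ) :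
    Set (MultiIndex n (2 * d) → ℝ) :=
  {y | y ∈ relaxedMomentCone g d δ ∧ y ⟨0, by simp⟩ = 1}

/-- The real power `M^q` of a symmetric matrix, i.e. `U diag(λ_i^q) Uᵀ` if `M = U diag(λ_i) Uᵀ`.
It is used for positive definite `M`, and for positive semidefinite `M` if `q > 0`. -/
def matrixPow {ι : Type} [Fintype ι] [DecidableEq ι] (M : Matrix ι ι ℝ) (q : ℝ) : Matrix ι ι ℝ :=
  cfc (fun t : ℝ => t ^ q) M

open Classical in
/-- Kiefer's criterion `φ_q` (real `q ≤ 1`) on positive semidefinite matrices of size `p`: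
`(trace(M^q)/p)^{1/q}` for positive definite `M` if `q ≠ 0`, and for all `M ⪰ 0` if `q > 0`;
`det(M)^{1/p}` for positive definite `M` if `q = 0`; `0` for singular `M ⪰ 0` if `q ≤ 0`. -/
def kieferCriterion {ι : Type} [Fintype ι] [DecidableEq ι] (q : ℝ) (M : Matrix ι ι ℝ) : ℝ :=
  if 0 < q ∨ (q ≠ 0 ∧ M.PosDef) then
    ((1 / (Fintype.card ι : ℝ)) * (matrixPow M q).trace) ^ (1 / q)
  else if M.PosDef then M.det ^ (1 / (Fintype.card ι : ℝ))
  else 0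

/-- `y` is an optimal solution of: maximize `φ_q(M_d(y))` over `y ∈ M^{SDP}_{2(d+δ)}(X)`,
`y_0 = 1`. -/
def IsOptimalSolution {n m : ℕ} (q : ℝ) (g : Fin m → MvPolynomial (Fin n) ℝ) (d δ : ℕ)
    (y : MultiIndex n (2 * d) → ℝ) : Prop :=
  y ∈ feasibleSet g d δ ∧
    ∀ z ∈ feasibleSet g d δ,
      kieferCriterion q (momentMatrix z) ≤ kieferCriterion q (momentMatrix y)

/-- The vector `v_d(x) = (x^α)_{|α| ≤ d}` of monomials. -/
def monomialVector (n d : ℕ) : MultiIndex n d → MvPolynomial (Fin n) ℝ :=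
  fun α => MvPolynomial.monomial α.1 1

/-- The polynomial `p_d(x) = v_d(x)ᵀ M_d(y)^{q-1} v_d(x)`. -/
def christoffelPolynomial {n d : ℕ} (q : ℝ) (y : MultiIndex n (2 * d) → ℝ) :
    MvPolynomial (Fin n) ℝ :=
  monomialVector n d ⬝ᵥ
    ((matrixPow (momentMatrix y) (q - 1)).map (MvPolynomial.C (σ := Fin n)) *ᵥ monomialVector n d)

/-- The polynomial `p = trace(M_d(y)^q) - p_d`. -/
def dualPolynomial {n d : ℕ} (q : ℝ) (y : MultiIndex n (2 * d) → ℝ) :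
    MvPolynomial (Fin n) ℝ :=
  MvPolynomial.C (matrixPow (momentMatrix y) q).trace - christoffelPolynomial q y

/-- `Σ[x]_{2k}`: the finite sums of squares of polynomials of degree at most `k`. -/
def sumsOfSquares (n k : ℕ) : Set (MvPolynomial (Fin n) ℝ) :=
  {σ | ∃ (N : ℕ) (h : Fin N → MvPolynomial (Fin n) ℝ),
    (∀ i, (h i).totalDegree ≤ k) ∧ σ = ∑ i, h i ^ 2}

/-- The truncated quadratic module `P^{SOS}_{2(d+δ)}(X)`: the polynomials
`h = σ_0 + ∑_j g_j σ_j` of degree at most `2d` with `σ_0 ∈ Σ[x]_{2(d+δ)}` and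
`σ_j ∈ Σ[x]_{2(d+δ-v_j)}`, `v_j = ⌈deg g_j / 2⌉`. A term with `v_j > d + δ` is absent. -/
def truncatedQuadraticModule {n m : ℕ} (g : Fin m → MvPolynomial (Fin n) ℝ) (d δ : ℕ) :
    Set (MvPolynomial (Fin n) ℝ) :=
  {h | h.totalDegree ≤ 2 * d ∧
    ∃ σ₀ ∈ sumsOfSquares n (d + δ), ∃ σ : Fin m → MvPolynomial (Fin n) ℝ,
      (∀ j, halfDegree (g j) ≤ d + δ → σ j ∈ sumsOfSquares n (d + δ - halfDegree (g j))) ∧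
      (∀ j, d + δ < halfDegree (g j) → σ j = 0) ∧
      h = σ₀ + ∑ j, g j * σ j}

end OptDesign

end

/-!
Write `A = M_d(y)`. Everything concerns `tracePotential q A = ∑ᵢ f (λᵢ(A))`, concave on `A ≻ 0`,
where `f` is the primitive `t ^ q / q` (or `log t`) of `t ^ (q - 1)`; Kiefer's criterion is an
increasing function of it (`kieferCriterion_le_iff`).

*Trace inequalities.* For symmetric `A`, `B` one has
`tr (f(A) h(B)) = ∑ᵢⱼ cᵢⱼ f(aᵢ) h(bⱼ)` with weights `cᵢⱼ ≥ 0` that depend only on eigenbases of `A`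
and `B` (`exists_trace_cfc_mul_cfc`). So the scalar tangent inequality for `f` gives Klein's
inequality, that the tangent of `tracePotential` at `A ≻ 0`, whose gradient is `A ^ (q - 1)`, lies
above it, with equality only at `A`; and a scalar second-order estimate bounds the gap. Hence
`tr (A ^ (q - 1) B) ≤ tr (A ^ q)` for all feasible `B` makes `A` the unique maximizer
(`kieferCriterion_le_of_trace_le`).

*Existence.* Klein's inequality encloses each superlevel set in an intersection of half-spaces, so
compactness provides a candidate maximizer on a compact convex set of positive semidefinite
matrices. It is nonsingular, as `f` has infinite slope at `0` and the set contains a positive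
definite matrix, and then the first-order condition above holds (`exists_posDef_forall_trace_le`). The feasible set is compact
because the ball constraint bounds all moments (`abs_le_of_mem_extendedMomentCone`), and the moments
of a grid inside the interior of `X` give a positive definite matrix
(`exists_mem_feasibleSet_posDef`).

*Duality.* Since `L_z(p_y) = tr (A ^ q) z_0 - tr (A ^ (q - 1) M_d(z))`, the first-order condition
says that `L_z(p_y) ≥ 0` on the relaxed moment cone. The truncated quadratic module is closed,
because no cancellation can occur between terms that are nonnegative on an open set, so it contains
every polynomial of degree at most `2d` that is nonnegative on the moment cone
(`mem_truncatedQuadraticModule_of_forall`). Conversely `p_y` in the module gives back the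
first-order condition.
-/

namespace OptDesign

/-! ### The scalar potential -/

/-- A concave primitive of `t ↦ t ^ (q - 1)` on `(0, ∞)`: `t ^ q / q`, or `log t` if `q = 0`. -/
noncomputable def potential (q t : ℝ) : ℝ := if q = 0 then Real.log t else t ^ q / q

theorem potential_lt_tangent {q : ℝ} (hq : q < 1) {a b : ℝ} (ha : 0 < a) (hb : 0 ≤ b)
    (hb' : 0 < q ∨ 0 < b) (hab : a ≠ b) :
    potential q b < potential q a + a ^ (q - 1) * (b - a) := by
  have hs : b / a - 1 ≠ 0 := by
    rw [sub_ne_zero, Ne, div_eq_one_iff_eq ha.ne']; exact hab.symm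
  have hs1 : -1 ≤ b / a - 1 := by have := div_nonneg hb ha.le; linarith
  have hba : 1 + (b / a - 1) = b / a := by ring
  have haq : 0 < a ^ q := Real.rpow_pos_of_pos ha q
  have hder : a ^ (q - 1) * (b - a) = a ^ q * (b / a - 1) := by
    rw [Real.rpow_sub_one ha.ne']; field_simp
  rw [hder]
  unfold potential
  rcases lt_trichotomy q 0 with h | h | h
  · have hb0 : 0 < b := by rcases hb' with h' | h' <;> [linarith; exact h']
    have key := one_add_mul_self_lt_rpow_one_add (s := a / b - 1)
      (by have := div_pos ha hb0; linarith)
      (by rw [sub_ne_zero, Ne, div_eq_one_iff_eq hb0.ne']; exact hab) (p := 1 - q) (by linarith)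
    have h1 : (1 + (a / b - 1)) ^ (1 - q) = a / b * (b ^ q / a ^ q) := by
      rw [show 1 + (a / b - 1) = a / b by ring, Real.rpow_sub (div_pos ha hb0), Real.rpow_one,
        Real.div_rpow ha.le hb0.le]
      field_simp
    rw [h1] at key
    simp only [h.ne, if_false]
    have h2 : b ^ q / q - (a ^ q / q + a ^ q * (b / a - 1))
        = (a ^ q * b / a) / q * (a / b * (b ^ q / a ^ q) - (1 + (1 - q) * (a / b - 1))) := by
      have := h.ne
      field_simp
      ring
    have h3 : (a ^ q * b / a) / q < 0 := div_neg_of_pos_of_neg (by positivity) h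
    nlinarith
  · subst h
    have hb0 : 0 < b := by rcases hb' with h' | h' <;> [exact absurd h' (lt_irrefl _); exact h']
    have := Real.log_lt_sub_one_of_pos (div_pos hb0 ha)
      (by rw [Ne, div_eq_one_iff_eq ha.ne']; exact hab.symm)
    rw [Real.log_div hb0.ne' ha.ne'] at this
    simp only [if_true, Real.rpow_zero]
    linarith
  · have key := rpow_one_add_lt_one_add_mul_self hs1 hs h hq
    rw [hba, Real.div_rpow hb ha.le, div_lt_iff₀ haq] at key
    simp only [h.ne', if_false]
    rw [div_lt_iff₀ h, add_mul, div_mul_cancel₀ _ h.ne']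
    linarith

theorem potential_le_tangent {q : ℝ} (hq : q < 1) {a b : ℝ} (ha : 0 < a) (hb : 0 ≤ b)
    (hb' : 0 < q ∨ 0 < b) :
    potential q b ≤ potential q a + a ^ (q - 1) * (b - a) := by
  rcases eq_or_ne a b with rfl | h
  · simp
  · exact (potential_lt_tangent hq ha hb hb' h).le

/-- On `[c, ∞)` the derivative `t ^ (q - 1)` of the potential is Lipschitz, so the tangent
inequality is sharp up to a quadratic error. -/
theorem exists_tangent_sub_sq_le_potential {q : ℝ} (hq : q < 1) {c : ℝ} (hc : 0 < c) :
    ∃ L : ℝ, ∀ a b : ℝ, c ≤ a → c ≤ b →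
      potential q a + a ^ (q - 1) * (b - a) - L * (b - a) ^ 2 ≤ potential q b := by
  -- For `a ≤ b`, the tangent inequality for `t ^ (q - 1)`, again a power with exponent below `1`,
  -- bounds `a ^ (q - 1) - b ^ (q - 1)` by `(1 - q) * c ^ (q - 2) * (b - a)`.
  have key : ∀ a b : ℝ, c ≤ a → a ≤ b →
      a ^ (q - 1) - b ^ (q - 1) ≤ (1 - q) * c ^ (q - 2) * (b - a) := by
    intro a b hca hab
    have ha : 0 < a := hc.trans_le hca
    have h := potential_le_tangent (q := q - 1) (by linarith) ha (ha.le.trans hab)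
      (.inr (ha.trans_le hab))
    have hq0 : q - 1 ≠ 0 := by linarith
    simp only [potential, hq0, if_false] at h
    rw [div_le_iff_of_neg (by linarith), add_mul, div_mul_cancel₀ _ hq0] at h
    have h2 : a ^ (q - 1 - 1) ≤ c ^ (q - 2) := by
      rw [show q - 1 - 1 = q - 2 by ring]
      exact Real.rpow_le_rpow_of_nonpos hc hca (by linarith)
    have h3 : (1 - q) * (b - a) * a ^ (q - 1 - 1) ≤ (1 - q) * (b - a) * c ^ (q - 2) :=
      mul_le_mul_of_nonneg_left h2 (mul_nonneg (by linarith) (by linarith))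
    linarith
  refine ⟨(1 - q) * c ^ (q - 2), fun a b hca hcb => ?_⟩
  have ha : 0 < a := hc.trans_le hca
  have hb : 0 < b := hc.trans_le hcb
  have h := potential_le_tangent hq hb ha.le (.inr ha)
  have h2 : (a ^ (q - 1) - b ^ (q - 1)) * (b - a) ≤ (1 - q) * c ^ (q - 2) * (b - a) ^ 2 := by
    rcases le_total a b with hab | hab
    · nlinarith [key a b hca hab]
    · nlinarith [key b a hcb hab]
  linarith

/-! ### Trace inequalities -/

section Spectral

variable {ι : Type} [Fintype ι] [DecidableEq ι]

/-- The weights `c i j` are the squared entries of the orthogonal matrix that relates eigenbases of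
`A` and `B`. Every trace inequality below is a termwise scalar inequality in this double sum. -/
theorem exists_trace_cfc_mul_cfc {A B : Matrix ι ι ℝ} (hA : A.IsHermitian) (hB : B.IsHermitian) :
    ∃ c : ι → ι → ℝ, (∀ i j, 0 ≤ c i j) ∧ ∀ f h : ℝ → ℝ,
      (cfc f A * cfc h B).trace
        = ∑ i, ∑ j, c i j * (f (hA.eigenvalues i) * h (hB.eigenvalues j)) := by
  set U : Matrix ι ι ℝ := (hA.eigenvectorUnitary : Matrix ι ι ℝ)
  set W : Matrix ι ι ℝ := (hB.eigenvectorUnitary : Matrix ι ι ℝ)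
  refine ⟨fun i j => ((star U * W) i j) ^ 2, fun i j => sq_nonneg _, fun f h => ?_⟩
  have h1 : cfc f A = U * Matrix.diagonal (f ∘ hA.eigenvalues) * star U := by
    rw [hA.cfc_eq, Matrix.IsHermitian.cfc, Unitary.conjStarAlgAut_apply]; rfl
  have h2 : cfc h B = W * Matrix.diagonal (h ∘ hB.eigenvalues) * star W := by
    rw [hB.cfc_eq, Matrix.IsHermitian.cfc, Unitary.conjStarAlgAut_apply]; rfl
  have h3 : (cfc f A * cfc h B).trace = (Matrix.diagonal (f ∘ hA.eigenvalues) * (star U * W) *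
      (Matrix.diagonal (h ∘ hB.eigenvalues) * star (star U * W))).trace := by
    rw [h1, h2, star_mul, star_star]
    simp only [Matrix.mul_assoc]
    rw [Matrix.trace_mul_comm]
    simp only [Matrix.mul_assoc]
  rw [h3, Matrix.trace]
  refine Finset.sum_congr rfl fun i _ => ?_
  rw [Matrix.diag_apply, Matrix.mul_apply]
  refine Finset.sum_congr rfl fun j _ => ?_
  rw [Matrix.diagonal_mul, Matrix.diagonal_mul, Matrix.star_apply]
  simp only [Function.comp, star_trivial]
  ring

theorem trace_cfc {A : Matrix ι ι ℝ} (hA : A.IsHermitian) (f : ℝ → ℝ) :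
    (cfc f A).trace = ∑ i, f (hA.eigenvalues i) := by
  rw [hA.cfc_eq, Matrix.IsHermitian.cfc, Unitary.conjStarAlgAut_apply, Matrix.trace_mul_comm,
    ← mul_assoc]
  simp [Matrix.trace]

theorem continuousOn_spectrum (A : Matrix ι ι ℝ) (f : ℝ → ℝ) : ContinuousOn f (spectrum ℝ A) :=
  A.finite_real_spectrum.continuousOn f

theorem trace_matrixPow_mul_self {A : Matrix ι ι ℝ} (hA : A.PosDef) (q : ℝ) :
    (matrixPow A (q - 1) * A).trace = (matrixPow A q).trace := by
  have hA' : IsSelfAdjoint A := hA.isHermitian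
  have h : matrixPow A (q - 1) * A = cfc (fun t : ℝ => t ^ (q - 1) * t) A := by
    rw [cfc_mul _ _ A (continuousOn_spectrum A _) (continuousOn_spectrum A _), cfc_id' ℝ A]; rfl
  rw [h, matrixPow, trace_cfc hA.isHermitian, trace_cfc hA.isHermitian]
  refine Finset.sum_congr rfl fun i _ => ?_
  rw [Real.rpow_sub_one (hA.eigenvalues_pos i).ne',
    div_mul_cancel₀ _ (hA.eigenvalues_pos i).ne']

theorem trace_matrixPow_mul_nonneg {A B : Matrix ι ι ℝ} (hA : A.PosSemidef) (hB : B.PosSemidef)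
    (r : ℝ) : 0 ≤ (matrixPow A r * B).trace := by
  obtain ⟨c, hc, h⟩ := exists_trace_cfc_mul_cfc hA.isHermitian hB.isHermitian
  have hB' : IsSelfAdjoint B := hB.isHermitian
  have := h (fun t => t ^ r) id
  rw [cfc_id ℝ B] at this
  rw [matrixPow, this]
  exact Finset.sum_nonneg fun i _ => Finset.sum_nonneg fun j _ => mul_nonneg (hc i j)
    (mul_nonneg (Real.rpow_nonneg (hA.eigenvalues_nonneg i) _) (hB.eigenvalues_nonneg j))

/-- The function `M ↦ ∑ᵢ f (λᵢ(M))` on symmetric matrices, where `f` is `potential q`. It is meant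
for positive definite `M`, and for positive semidefinite `M` if `q > 0`; there Kiefer's criterion
`φ_q` is an increasing function of it. For `q ≤ 0` its values at singular `M` are junk. -/
noncomputable def tracePotential (q : ℝ) (M : Matrix ι ι ℝ) : ℝ := (cfc (potential q) M).trace

/-- The remainder of the first-order expansion of `tracePotential` at `A`, as a double sum. -/
theorem exists_tracePotential_remainder {A B : Matrix ι ι ℝ} (hA : A.PosDef)
    (hB : B.PosSemidef) (q : ℝ) :
    ∃ c : ι → ι → ℝ, (∀ i j, 0 ≤ c i j) ∧
      (tracePotential q A + (matrixPow A (q - 1) * (B - A)).trace - tracePotential q B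
        = ∑ i, ∑ j, c i j * (potential q (hA.isHermitian.eigenvalues i)
          + hA.isHermitian.eigenvalues i ^ (q - 1)
            * (hB.isHermitian.eigenvalues j - hA.isHermitian.eigenvalues i)
          - potential q (hB.isHermitian.eigenvalues j))) ∧
      ((B - A) * (B - A)).trace = ∑ i, ∑ j, c i j *
        (hB.isHermitian.eigenvalues j - hA.isHermitian.eigenvalues i) ^ 2 := by
  obtain ⟨c, hc, h⟩ := exists_trace_cfc_mul_cfc hA.isHermitian hB.isHermitian
  have hA' : IsSelfAdjoint A := hA.isHermitian
  have hB' : IsSelfAdjoint B := hB.isHermitian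
  have h1A : cfc (fun _ : ℝ => (1 : ℝ)) A = 1 := cfc_const_one ℝ A
  have h1B : cfc (fun _ : ℝ => (1 : ℝ)) B = 1 := cfc_const_one ℝ B
  have hsqA : cfc (fun t : ℝ => t * t) A = A * A := by
    rw [cfc_mul _ _ A (continuousOn_spectrum A _) (continuousOn_spectrum A _), cfc_id' ℝ A]
  have hsqB : cfc (fun t : ℝ => t * t) B = B * B := by
    rw [cfc_mul _ _ B (continuousOn_spectrum B _) (continuousOn_spectrum B _), cfc_id' ℝ B]
  have hgrad : cfc (fun t : ℝ => t ^ (q - 1) * t) A = matrixPow A (q - 1) * A := by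
    rw [cfc_mul _ _ A (continuousOn_spectrum A _) (continuousOn_spectrum A _), cfc_id' ℝ A]; rfl
  refine ⟨c, hc, ?_, ?_⟩
  · have e1 := h (potential q) (fun _ => 1)
    have e2 := h (fun t => t ^ (q - 1)) (fun t => t)
    have e3 := h (fun t => t ^ (q - 1) * t) (fun _ => 1)
    have e4 := h (fun _ => 1) (potential q)
    rw [h1B, mul_one] at e1 e3
    rw [h1A, one_mul] at e4
    rw [cfc_id' ℝ B] at e2
    rw [hgrad] at e3
    rw [tracePotential, tracePotential, mul_sub, Matrix.trace_sub, e1, e3, e4, matrixPow, e2,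
      ← Finset.sum_sub_distrib, ← Finset.sum_add_distrib, ← Finset.sum_sub_distrib]
    refine Finset.sum_congr rfl fun i _ => ?_
    rw [← Finset.sum_sub_distrib, ← Finset.sum_add_distrib, ← Finset.sum_sub_distrib]
    refine Finset.sum_congr rfl fun j _ => ?_
    ring
  · have e1 := h (fun t => t * t) (fun _ => 1)
    have e2 := h (fun t => t) (fun t => t)
    have e3 := h (fun _ => 1) (fun t => t * t)
    rw [h1B, mul_one, hsqA] at e1
    rw [h1A, one_mul, hsqB] at e3
    rw [cfc_id' ℝ A, cfc_id' ℝ B] at e2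
    have : ((B - A) * (B - A)).trace
        = (B * B).trace - 2 * (A * B).trace + (A * A).trace := by
      rw [sub_mul, mul_sub, mul_sub]
      simp only [Matrix.trace_sub]
      rw [Matrix.trace_mul_comm B A]
      ring
    rw [this, e1, e2, e3, Finset.mul_sum, ← Finset.sum_sub_distrib, ← Finset.sum_add_distrib]
    refine Finset.sum_congr rfl fun i _ => ?_
    rw [Finset.mul_sum, ← Finset.sum_sub_distrib, ← Finset.sum_add_distrib]
    refine Finset.sum_congr rfl fun j _ => ?_
    ring

/-- Klein's inequality for the potential: a tangent to `tracePotential` lies above it. -/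
theorem tracePotential_le_tangent {q : ℝ} (hq : q < 1) {A B : Matrix ι ι ℝ} (hA : A.PosDef)
    (hB : B.PosSemidef) (hB' : 0 < q ∨ B.PosDef) :
    tracePotential q B ≤ tracePotential q A + (matrixPow A (q - 1) * (B - A)).trace := by
  obtain ⟨c, hc, h, -⟩ := exists_tracePotential_remainder hA hB q
  rw [← sub_nonneg, h]
  refine Finset.sum_nonneg fun i _ => Finset.sum_nonneg fun j _ => mul_nonneg (hc i j) ?_
  rw [sub_nonneg]
  exact potential_le_tangent hq (hA.eigenvalues_pos i) (hB.eigenvalues_nonneg j)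
    (hB'.imp id fun h => h.eigenvalues_pos j)

/-- The equality case of Klein's inequality. -/
theorem eq_of_tangent_le_tracePotential {q : ℝ} (hq : q < 1) {A B : Matrix ι ι ℝ}
    (hA : A.PosDef) (hB : B.PosSemidef) (hB' : 0 < q ∨ B.PosDef)
    (hle : tracePotential q A + (matrixPow A (q - 1) * (B - A)).trace ≤ tracePotential q B) :
    B = A := by
  obtain ⟨c, hc, h, hsq⟩ := exists_tracePotential_remainder hA hB q
  have hterm : ∀ i j, 0 ≤ c i j * (potential q (hA.isHermitian.eigenvalues i)
          + hA.isHermitian.eigenvalues i ^ (q - 1)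
            * (hB.isHermitian.eigenvalues j - hA.isHermitian.eigenvalues i)
          - potential q (hB.isHermitian.eigenvalues j)) := fun i j =>
    mul_nonneg (hc i j) (sub_nonneg.2 (potential_le_tangent hq (hA.eigenvalues_pos i)
      (hB.eigenvalues_nonneg j) (hB'.imp id fun h => h.eigenvalues_pos j)))
  have hzero := h.symm.trans_le (sub_nonpos.2 hle)
  have hz : ∀ i j, c i j * (hB.isHermitian.eigenvalues j - hA.isHermitian.eigenvalues i) ^ 2
      = 0 := by
    intro i j
    have h0 := (Finset.sum_eq_zero_iff_of_nonneg fun i _ =>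
      Finset.sum_nonneg fun j _ => hterm i j).1
      (le_antisymm hzero (Finset.sum_nonneg fun i _ => Finset.sum_nonneg fun j _ => hterm i j))
      i (Finset.mem_univ _)
    have h1 := (Finset.sum_eq_zero_iff_of_nonneg fun j _ => hterm i j).1 h0 j (Finset.mem_univ _)
    rcases mul_eq_zero.1 h1 with h1 | h1
    · simp [h1]
    · have : hA.isHermitian.eigenvalues i = hB.isHermitian.eigenvalues j := by
        by_contra hne
        exact absurd h1 (sub_pos.2 (potential_lt_tangent hq (hA.eigenvalues_pos i)
          (hB.eigenvalues_nonneg j) (hB'.imp id fun h => h.eigenvalues_pos j) hne)).ne'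
      simp [this]
  have htr : ((B - A) * (B - A)).trace = 0 := by
    rw [hsq]; exact Finset.sum_eq_zero fun i _ => Finset.sum_eq_zero fun j _ => hz i j
  have hBA : (B - A)ᴴ = B - A := hB.isHermitian.sub hA.isHermitian
  have : ((B - A)ᴴ * (B - A)).trace = 0 := by rw [hBA]; exact htr
  exact sub_eq_zero.1 (Matrix.trace_conjTranspose_mul_self_eq_zero_iff.1 this)

theorem tracePotential_mono {q : ℝ} (hq : q < 1) {A B : Matrix ι ι ℝ} (hA : A.PosSemidef)
    (hA' : 0 < q ∨ A.PosDef) (hB : B.PosDef) (hAB : (B - A).PosSemidef) :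
    tracePotential q A ≤ tracePotential q B := by
  have h := tracePotential_le_tangent hq hB hA hA'
  have h2 := trace_matrixPow_mul_nonneg hB.posSemidef hAB (q - 1)
  rw [← neg_sub B A, mul_neg, Matrix.trace_neg] at h
  linarith

theorem tracePotential_cfc {q : ℝ} {A : Matrix ι ι ℝ} (hA : A.IsHermitian) (h : ℝ → ℝ) :
    tracePotential q (cfc h A) = ∑ i, potential q (h (hA.eigenvalues i)) := by
  have hA' : IsSelfAdjoint A := hA
  rw [tracePotential, ← cfc_comp (potential q) h A hA'
    ((A.finite_real_spectrum.image h).continuousOn _) (continuousOn_spectrum A _), trace_cfc hA]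
  rfl

theorem cfc_affine {A : Matrix ι ι ℝ} (hA : A.IsHermitian) (s u : ℝ) :
    cfc (fun t : ℝ => s * t + u) A = s • A + u • (1 : Matrix ι ι ℝ) := by
  have hA' : IsSelfAdjoint A := hA
  rw [cfc_add_const u _ A (continuousOn_spectrum A _), cfc_const_mul s _ A
    (continuousOn_spectrum A _), cfc_id' ℝ A, Algebra.algebraMap_eq_smul_one]

theorem tracePotential_affine {q : ℝ} {A : Matrix ι ι ℝ} (hA : A.IsHermitian) (s u : ℝ) :
    tracePotential q (s • A + u • (1 : Matrix ι ι ℝ))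
      = ∑ i, potential q (s * hA.eigenvalues i + u) := by
  rw [← cfc_affine hA, tracePotential_cfc hA]

theorem posSemidef_sub_smul_one {A : Matrix ι ι ℝ} (hA : A.IsHermitian) {c : ℝ} :
    (A - c • (1 : Matrix ι ι ℝ)).PosSemidef ↔ ∀ i, c ≤ hA.eigenvalues i := by
  have hH : (A - c • (1 : Matrix ι ι ℝ)).IsHermitian :=
    hA.sub (by simp [Matrix.IsHermitian])
  have key : A - c • (1 : Matrix ι ι ℝ) = (hA.eigenvectorUnitary : Matrix ι ι ℝ) *
      Matrix.diagonal (fun i => hA.eigenvalues i - c) *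
        star (hA.eigenvectorUnitary : Matrix ι ι ℝ) := by
    have := cfc_affine hA 1 (-c)
    rw [one_smul, neg_smul, ← sub_eq_add_neg] at this
    rw [← this, hA.cfc_eq, Matrix.IsHermitian.cfc, Unitary.conjStarAlgAut_apply]
    congr 3
    ext i
    simp; ring
  rw [key, Matrix.IsUnit.posSemidef_star_right_conjugate_iff
    (Unitary.isUnit_coe), Matrix.posSemidef_diagonal_iff]
  simp

theorem exists_pos_posSemidef_sub_smul_one {A : Matrix ι ι ℝ} (hA : A.PosDef) :
    ∃ c : ℝ, 0 < c ∧ (A - c • (1 : Matrix ι ι ℝ)).PosSemidef := by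
  obtain ⟨c, hc, h⟩ : ∃ c : ℝ, 0 < c ∧ ∀ i, c ≤ hA.isHermitian.eigenvalues i := by
    rcases isEmpty_or_nonempty ι with hι | hι
    · exact ⟨1, one_pos, fun i => hι.elim i⟩
    · obtain ⟨i, hi⟩ := Finite.exists_min hA.isHermitian.eigenvalues
      exact ⟨_, hA.eigenvalues_pos i, hi⟩
  exact ⟨c, hc, (posSemidef_sub_smul_one hA.isHermitian).2 h⟩

/-- On matrices bounded below by `c > 0`, the tangent inequality is sharp up to a quadratic
error; this replaces differentiability of `tracePotential`. -/
theorem exists_tangent_sub_sq_le_tracePotential {q : ℝ} (hq : q < 1) {c : ℝ} (hc : 0 < c) :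
    ∃ L : ℝ, ∀ A B : Matrix ι ι ℝ, A.PosDef → B.PosDef →
      (A - c • (1 : Matrix ι ι ℝ)).PosSemidef → (B - c • (1 : Matrix ι ι ℝ)).PosSemidef →
      tracePotential q A + (matrixPow A (q - 1) * (B - A)).trace
        - L * ((B - A) * (B - A)).trace ≤ tracePotential q B := by
  obtain ⟨L, hL⟩ := exists_tangent_sub_sq_le_potential hq hc
  refine ⟨L, fun A B hA hB hcA hcB => ?_⟩
  obtain ⟨w, hw, h, hsq⟩ := exists_tracePotential_remainder hA hB.posSemidef q
  rw [posSemidef_sub_smul_one hA.isHermitian] at hcA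
  rw [posSemidef_sub_smul_one hB.isHermitian] at hcB
  have : tracePotential q A + (matrixPow A (q - 1) * (B - A)).trace - tracePotential q B
      ≤ L * ((B - A) * (B - A)).trace := by
    rw [h, hsq, Finset.mul_sum]
    refine Finset.sum_le_sum fun i _ => ?_
    rw [Finset.mul_sum]
    refine Finset.sum_le_sum fun j _ => ?_
    have := mul_le_mul_of_nonneg_left (hL _ _ (hcA i) (hcB j)) (hw i j)
    linarith
  linarith

/-! ### Kiefer's criterion and the potential -/

theorem kieferCriterion_le_iff [Nonempty ι] {q : ℝ} {A B : Matrix ι ι ℝ}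
    (hA : A.PosSemidef) (hA' : 0 < q ∨ A.PosDef) (hB : B.PosSemidef) (hB' : 0 < q ∨ B.PosDef) :
    kieferCriterion q B ≤ kieferCriterion q A ↔ tracePotential q B ≤ tracePotential q A := by
  have hcard : (0 : ℝ) < Fintype.card ι := by exact_mod_cast Fintype.card_pos
  rcases eq_or_ne q 0 with rfl | hq0
  · have hA' : A.PosDef := hA'.resolve_left (lt_irrefl _)
    have hB' : B.PosDef := hB'.resolve_left (lt_irrefl _)
    simp only [kieferCriterion, lt_irrefl, ne_eq, not_true_eq_false, false_and, or_self, if_false,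
      hA', hB', if_true]
    have hdet : ∀ {M : Matrix ι ι ℝ}, M.PosDef → tracePotential 0 M = Real.log M.det := by
      intro M hM
      rw [tracePotential, trace_cfc hM.isHermitian, hM.isHermitian.det_eq_prod_eigenvalues]
      simp only [RCLike.ofReal_real_eq_id, id]
      rw [Real.log_prod (fun i _ => (hM.eigenvalues_pos i).ne')]
      simp [potential]
    rw [hdet hA', hdet hB', Real.log_le_log_iff hB'.det_pos hA'.det_pos]
    exact Real.rpow_le_rpow_iff hB'.det_pos.le hA'.det_pos.le (by positivity)
  · have hcond : ∀ {M : Matrix ι ι ℝ}, 0 < q ∨ M.PosDef → (0 < q ∨ (q ≠ 0 ∧ M.PosDef)) :=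
      fun h => h.imp id fun h => ⟨hq0, h⟩
    have hF : ∀ {M : Matrix ι ι ℝ}, M.PosSemidef →
        tracePotential q M = (matrixPow M q).trace / q := by
      intro M hM
      rw [tracePotential, matrixPow, trace_cfc hM.isHermitian, trace_cfc hM.isHermitian,
        Finset.sum_div]
      simp [potential, hq0]
    rw [hF hA, hF hB]
    simp only [kieferCriterion, hcond hB', hcond hA', if_true]
    have hnn : ∀ {M : Matrix ι ι ℝ}, M.PosSemidef → 0 ≤ (matrixPow M q).trace := by
      intro M hM
      rw [matrixPow, trace_cfc hM.isHermitian]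
      exact Finset.sum_nonneg fun i _ => Real.rpow_nonneg (hM.eigenvalues_nonneg i) _
    have hc : 0 < 1 / (Fintype.card ι : ℝ) := by positivity
    rcases lt_or_gt_of_ne hq0 with hneg | hq
    · have hpos : ∀ {M : Matrix ι ι ℝ}, 0 < q ∨ M.PosDef → 0 < (matrixPow M q).trace := by
        intro M hM
        replace hM := hM.resolve_left hneg.not_gt
        rw [matrixPow, trace_cfc hM.isHermitian]
        exact Finset.sum_pos (fun i _ => Real.rpow_pos_of_pos (hM.eigenvalues_pos i) _)
          Finset.univ_nonempty
      rw [Real.rpow_le_rpow_iff_of_neg (mul_pos hc (hpos hB')) (mul_pos hc (hpos hA'))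
        (one_div_neg.2 hneg), mul_le_mul_iff_right₀ hc, div_le_div_right_of_neg hneg]
    · rw [Real.rpow_le_rpow_iff (mul_nonneg hc.le (hnn hB)) (mul_nonneg hc.le (hnn hA))
        (one_div_pos.2 hq), mul_le_mul_iff_right₀ hc, div_le_div_iff_of_pos_right hq]

theorem kieferCriterion_pos [Nonempty ι] (q : ℝ) {A : Matrix ι ι ℝ} (hA : A.PosDef) :
    0 < kieferCriterion q A := by
  have hcard : (0 : ℝ) < Fintype.card ι := by exact_mod_cast Fintype.card_pos
  unfold kieferCriterion
  split_ifs
  · refine Real.rpow_pos_of_pos (mul_pos (by positivity) ?_) _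
    rw [matrixPow, trace_cfc hA.isHermitian]
    exact Finset.sum_pos (fun i _ => Real.rpow_pos_of_pos (hA.eigenvalues_pos i) _)
      Finset.univ_nonempty
  · exact Real.rpow_pos_of_pos hA.det_pos _

/-- The gradient inequality `tr (A ^ (q - 1) * B) ≤ tr (A ^ q)` is sufficient for `A` to be at least
as good as `B`, and strictly better unless `B = A`. -/
theorem kieferCriterion_le_of_trace_le [Nonempty ι] {q : ℝ} (hq : q < 1) {A B : Matrix ι ι ℝ}
    (hA : A.PosDef) (hB : B.PosSemidef)
    (h : (matrixPow A (q - 1) * B).trace ≤ (matrixPow A q).trace) :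
    kieferCriterion q B ≤ kieferCriterion q A ∧
      (kieferCriterion q A ≤ kieferCriterion q B → B = A) := by
  by_cases hB' : 0 < q ∨ B.PosDef
  · have hgrad : (matrixPow A (q - 1) * (B - A)).trace ≤ 0 := by
      rw [mul_sub, Matrix.trace_sub, trace_matrixPow_mul_self hA]
      linarith
    have hA' : 0 < q ∨ A.PosDef := .inr hA
    refine ⟨(kieferCriterion_le_iff hA.posSemidef hA' hB hB').2 ?_, fun hle => ?_⟩
    · linarith [tracePotential_le_tangent hq hA hB hB']
    · have := (kieferCriterion_le_iff hB hB' hA.posSemidef hA').1 hle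
      exact eq_of_tangent_le_tracePotential hq hA hB hB' (by linarith)
  · have hzero : kieferCriterion q B = 0 := by
      rw [not_or] at hB'
      simp [kieferCriterion, hB'.1, hB'.2]
    have hpos := kieferCriterion_pos q hA
    exact ⟨hzero ▸ hpos.le, fun hle => absurd hle (by rw [hzero]; exact hpos.not_ge)⟩

end Spectral

/-! ### Maximizers over convex compact sets of matrices -/

section Maximizer

variable {ι : Type} [Fintype ι] [DecidableEq ι]

/-- The sets of matrices on which all tangents of `tracePotential` are at least `tracePotential q Z`
are closed and, by Klein's inequality, have the finite intersection property as `Z` varies. A common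
point is a candidate maximizer, which may a priori be singular. -/
theorem exists_forall_tracePotential_le_tangent {q : ℝ} (hq : q < 1)
    {K : Set (Matrix ι ι ℝ)} (hK : IsCompact K) (hne : K.Nonempty) :
    ∃ A ∈ K, ∀ Z ∈ K, Z.PosDef → ∀ C : Matrix ι ι ℝ, C.PosDef →
      tracePotential q Z ≤ tracePotential q C + (matrixPow C (q - 1) * (A - C)).trace := by
  let P : Type := {Z : Matrix ι ι ℝ // Z ∈ K ∧ Z.PosDef}
  let T : P → Set (Matrix ι ι ℝ) := fun Z => {A | ∀ C : Matrix ι ι ℝ, C.PosDef →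
      tracePotential q Z.1 ≤ tracePotential q C + (matrixPow C (q - 1) * (A - C)).trace}
  have hcl : ∀ Z, IsClosed (T Z) := by
    intro Z
    simp only [T, Set.ofPred_forall]
    refine isClosed_iInter fun C => isClosed_iInter fun _ => isClosed_le continuous_const ?_
    fun_prop
  obtain ⟨A, hAK, hA⟩ := hK.inter_iInter_nonempty T hcl (by
    intro u
    rcases u.eq_empty_or_nonempty with rfl | hu
    · simpa using hne
    · obtain ⟨Z, hZ, hmax⟩ := u.exists_max_image (fun Z => tracePotential q Z.1) hu
      refine ⟨Z.1, Z.2.1, Set.mem_iInter₂.2 fun Y hY C hC => (hmax Y hY).trans ?_⟩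
      exact tracePotential_le_tangent hq hC Z.2.2.posSemidef (.inr Z.2.2))
  exact ⟨A, hAK, fun Z hZ hZ' C hC => Set.mem_iInter.1 hA ⟨Z, hZ, hZ'⟩ C hC⟩

/-- The slope of `potential q` at `0` is infinite, so a maximizer is nonsingular. -/
theorem posDef_of_forall_tracePotential_le_tangent {q : ℝ} (hq : q < 1)
    {K : Set (Matrix ι ι ℝ)} (hconv : Convex ℝ K) (hpsd : ∀ M ∈ K, M.PosSemidef)
    {Z₀ : Matrix ι ι ℝ} (hZ₀ : Z₀ ∈ K) (hZ₀' : Z₀.PosDef) {A : Matrix ι ι ℝ} (hAK : A ∈ K)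
    (hA : ∀ Z ∈ K, Z.PosDef → ∀ C : Matrix ι ι ℝ, C.PosDef →
      tracePotential q Z ≤ tracePotential q C + (matrixPow C (q - 1) * (A - C)).trace) :
    A.PosDef := by
  have hApsd := hpsd A hAK
  have hAH := hApsd.isHermitian
  obtain ⟨η, hη, hZη⟩ := exists_pos_posSemidef_sub_smul_one hZ₀'
  set a := hAH.eigenvalues
  have ha : ∀ i, 0 ≤ a i := hApsd.eigenvalues_nonneg
  -- Compare `(1 - t) A + t η` with the feasible `(1 - t) A + t Z₀` above it, and the latter with
  -- `A + t η / 2` through the hypothesis on `A`.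
  have hsum : ∀ t : ℝ, 0 < t → t < 1 →
      ∑ i, ((1 - t) * a i + t * η) ^ (q - 1) * (η / 2 - a i) ≤ 0 := by
    intro t ht ht1
    have hx : ∀ i, 0 < (1 - t) * a i + t * η := fun i =>
      add_pos_of_nonneg_of_pos (mul_nonneg (by linarith) (ha i)) (mul_pos ht hη)
    set Z := (1 - t) • A + t • Z₀
    have hZK : Z ∈ K := hconv hAK hZ₀ (by linarith) ht.le (by ring)
    have hZpd : Z.PosDef := .posSemidef_add (hApsd.smul (by linarith)) (hZ₀'.smul ht)
    set W := (1 - t) • A + (t * η) • (1 : Matrix ι ι ℝ)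
    have hWpd : W.PosDef :=
      .posSemidef_add (hApsd.smul (by linarith)) (Matrix.PosDef.one.smul (mul_pos ht hη))
    have hWZ : (Z - W).PosSemidef := by
      have : Z - W = t • (Z₀ - η • (1 : Matrix ι ι ℝ)) := by
        simp only [Z, W, smul_sub, smul_smul]; abel
      rw [this]
      exact hZη.smul ht.le
    have h1 := tracePotential_mono hq hWpd.posSemidef (.inr hWpd) hZpd hWZ
    set C := (1 : ℝ) • A + (t * η / 2) • (1 : Matrix ι ι ℝ)
    have hCpd : C.PosDef :=
      .posSemidef_add (hApsd.smul (by linarith)) (Matrix.PosDef.one.smul (by positivity))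
    have h2 := hA Z hZK hZpd C hCpd
    have h3 := trace_matrixPow_mul_nonneg hCpd.posSemidef
      (Matrix.PosSemidef.one.smul (by positivity : 0 ≤ t * η / 2)) (q - 1)
    have h4 : A - C = -((t * η / 2) • (1 : Matrix ι ι ℝ)) := by
      simp only [C, one_smul]; abel
    rw [h4, mul_neg, Matrix.trace_neg] at h2
    have h5 : tracePotential q W ≤ tracePotential q C := by linarith
    rw [tracePotential_affine hAH, tracePotential_affine hAH] at h5
    have h6 : ∀ i, potential q (1 * a i + t * η / 2) ≤ potential q ((1 - t) * a i + t * η)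
        - t * (((1 - t) * a i + t * η) ^ (q - 1) * (η / 2 - a i)) := by
      intro i
      have hpos : 0 < 1 * a i + t * η / 2 := by
        have := ha i; have := mul_pos ht hη; linarith
      have := potential_le_tangent hq (hx i) hpos.le (.inr hpos)
      linarith
    have h7 := h5.trans (Finset.sum_le_sum fun i _ => h6 i)
    rw [Finset.sum_sub_distrib, ← Finset.mul_sum] at h7
    have h8 : t * ∑ i, ((1 - t) * a i + t * η) ^ (q - 1) * (η / 2 - a i) ≤ 0 := by linarith
    exact nonpos_of_mul_nonpos_right h8 ht
  rw [hAH.posDef_iff_eigenvalues_pos]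
  by_contra hcon
  obtain ⟨i₀, hi₀⟩ := not_forall.1 hcon
  replace hi₀ : a i₀ = 0 := le_antisymm (not_lt.1 hi₀) (ha i₀)
  -- All summands are bounded below as `t → 0`, and the one with `a i₀ = 0` tends to infinity.
  have hbound : ∀ t : ℝ, 0 < t → t ≤ 1 / 2 →
      (t * η) ^ (q - 1) * (η / 2) ≤ ∑ i, a i * (a i / 2) ^ (q - 1) := by
    intro t ht ht1
    have hs := hsum t ht (by linarith)
    rw [← Finset.add_sum_erase _ _ (Finset.mem_univ i₀), hi₀] at hs
    rw [mul_zero, zero_add, sub_zero] at hs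
    have hterm : ∀ i, -(a i * (a i / 2) ^ (q - 1))
        ≤ ((1 - t) * a i + t * η) ^ (q - 1) * (η / 2 - a i) := by
      intro i
      have htη := mul_pos ht hη
      rcases (ha i).eq_or_lt with h0 | h0
      · rw [← h0]
        have : 0 ≤ ((1 - t) * 0 + t * η) ^ (q - 1) := Real.rpow_nonneg (by linarith) _
        have := mul_nonneg this (half_pos hη).le
        simpa using this
      · have hle : a i / 2 ≤ (1 - t) * a i + t * η := by nlinarith
        have h1 := Real.rpow_le_rpow_of_nonpos (half_pos h0) hle (by linarith : q - 1 ≤ 0)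
        have h2 : 0 ≤ ((1 - t) * a i + t * η) ^ (q - 1) :=
          Real.rpow_nonneg ((half_pos h0).le.trans hle) _
        nlinarith [mul_le_mul_of_nonneg_left h1 h0.le, mul_nonneg h2 hη.le]
    have h1 := Finset.sum_le_sum fun i (_ : i ∈ Finset.univ.erase i₀) => hterm i
    rw [Finset.sum_neg_distrib] at h1
    have h2 : ∑ i ∈ Finset.univ.erase i₀, a i * (a i / 2) ^ (q - 1)
        ≤ ∑ i, a i * (a i / 2) ^ (q - 1) :=
      Finset.sum_le_sum_of_subset_of_nonneg (Finset.erase_subset _ _) fun i _ _ =>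
        mul_nonneg (ha i) (Real.rpow_nonneg (by linarith [ha i]) _)
    linarith
  have hlim : Filter.Tendsto (fun t : ℝ => (t * η) ^ (q - 1) * (η / 2))
      (nhdsWithin 0 (Set.Ioi 0)) Filter.atTop := by
    refine Filter.Tendsto.atTop_mul_const (half_pos hη) ?_
    refine (tendsto_rpow_neg_nhdsGT_zero (y := q - 1) (by linarith)).comp ?_
    refine tendsto_nhdsWithin_iff.2 ⟨?_, ?_⟩
    · have : Continuous fun t : ℝ => t * η := by fun_prop
      have := this.tendsto 0
      rw [zero_mul] at this
      exact this.mono_left nhdsWithin_le_nhds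
    · filter_upwards [self_mem_nhdsWithin] with t ht
      exact mul_pos ht hη
  have hev := hlim.eventually_gt_atTop (∑ i, a i * (a i / 2) ^ (q - 1))
  have hev2 : ∀ᶠ t : ℝ in nhdsWithin 0 (Set.Ioi 0), t ≤ 1 / 2 :=
    nhdsWithin_le_nhds (Iic_mem_nhds (by norm_num))
  obtain ⟨t, h1, h2, h3⟩ := (hev.and (hev2.and self_mem_nhdsWithin)).exists
  exact absurd (hbound t h3 h2) (not_le.2 h1)

/-- First-order optimality of a nonsingular maximizer. -/
theorem trace_le_of_forall_tracePotential_le {q : ℝ} (hq : q < 1)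
    {K : Set (Matrix ι ι ℝ)} (hconv : Convex ℝ K) (hpsd : ∀ M ∈ K, M.PosSemidef)
    {A : Matrix ι ι ℝ} (hAK : A ∈ K) (hA : A.PosDef)
    (hmax : ∀ Z ∈ K, Z.PosDef → tracePotential q Z ≤ tracePotential q A)
    {B : Matrix ι ι ℝ} (hB : B ∈ K) :
    (matrixPow A (q - 1) * B).trace ≤ (matrixPow A q).trace := by
  obtain ⟨c, hc, hcA⟩ := exists_pos_posSemidef_sub_smul_one hA
  obtain ⟨L, hL⟩ := exists_tangent_sub_sq_le_tracePotential (ι := ι) hq (half_pos hc)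
  set D := (matrixPow A (q - 1) * (B - A)).trace
  set N := ((B - A) * (B - A)).trace
  have key : ∀ t : ℝ, 0 < t → t < 1 / 2 → D ≤ t * (L * N) := by
    intro t ht ht2
    set Z := (1 - t) • A + t • B
    have hZK : Z ∈ K := hconv hAK hB (by linarith) ht.le (by ring)
    have hZpd : Z.PosDef :=
      .add_posSemidef (hA.smul (by linarith)) ((hpsd B hB).smul ht.le)
    have h1 : (A - (c / 2) • (1 : Matrix ι ι ℝ)).PosSemidef := by
      have : A - (c / 2) • (1 : Matrix ι ι ℝ)
          = (A - c • (1 : Matrix ι ι ℝ)) + (c / 2) • (1 : Matrix ι ι ℝ) := by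
        module
      rw [this]
      exact hcA.add (Matrix.PosSemidef.one.smul (half_pos hc).le)
    have h2 : (Z - (c / 2) • (1 : Matrix ι ι ℝ)).PosSemidef := by
      have : Z - (c / 2) • (1 : Matrix ι ι ℝ) = (1 - t) • (A - c • (1 : Matrix ι ι ℝ))
          + t • B + ((1 - t) * c - c / 2) • (1 : Matrix ι ι ℝ) := by
        simp only [Z]; module
      rw [this]
      exact ((hcA.smul (by linarith)).add ((hpsd B hB).smul ht.le)).add
        (Matrix.PosSemidef.one.smul (by nlinarith))
    have h3 := hL A Z hA hZpd h1 h2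
    have h4 : Z - A = t • (B - A) := by simp only [Z]; module
    rw [h4, Matrix.mul_smul, Matrix.trace_smul, Matrix.smul_mul, Matrix.mul_smul,
      Matrix.trace_smul, Matrix.trace_smul] at h3
    have h5 := hmax Z hZK hZpd
    simp only [smul_eq_mul] at h3
    have h6 : t * D ≤ t * (t * (L * N)) := by
      simp only [D, N]; linarith
    exact le_of_mul_le_mul_left h6 ht
  have hD : D ≤ 0 := by
    have hlim : Filter.Tendsto (fun t : ℝ => t * (L * N)) (nhdsWithin 0 (Set.Ioi 0)) (nhds 0) := by
      have : Continuous fun t : ℝ => t * (L * N) := by fun_prop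
      have := this.tendsto 0
      rw [zero_mul] at this
      exact this.mono_left nhdsWithin_le_nhds
    refine ge_of_tendsto hlim ?_
    filter_upwards [self_mem_nhdsWithin,
      nhdsWithin_le_nhds (Iio_mem_nhds (by norm_num : (0 : ℝ) < 1 / 2))] with t ht ht2
    exact key t ht ht2
  simp only [D] at hD
  rw [mul_sub, Matrix.trace_sub, trace_matrixPow_mul_self hA] at hD
  linarith

/-- A convex compact set of positive semidefinite matrices that contains a positive definite matrix
contains a positive definite one that satisfies the first-order optimality condition. -/
theorem exists_posDef_forall_trace_le {q : ℝ} (hq : q < 1) {K : Set (Matrix ι ι ℝ)}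
    (hK : IsCompact K) (hconv : Convex ℝ K) (hpsd : ∀ M ∈ K, M.PosSemidef)
    {Z₀ : Matrix ι ι ℝ} (hZ₀ : Z₀ ∈ K) (hZ₀' : Z₀.PosDef) :
    ∃ A ∈ K, A.PosDef ∧ ∀ B ∈ K,
      (matrixPow A (q - 1) * B).trace ≤ (matrixPow A q).trace := by
  obtain ⟨A, hAK, hA⟩ := exists_forall_tracePotential_le_tangent hq hK ⟨Z₀, hZ₀⟩
  have hApd := posDef_of_forall_tracePotential_le_tangent hq hconv hpsd hZ₀ hZ₀' hAK hA
  refine ⟨A, hAK, hApd, fun B hB => trace_le_of_forall_tracePotential_le hq hconv hpsd hAK hApd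
    (fun Z hZ hZ' => ?_) hB⟩
  simpa using hA Z hZ hZ' A hApd

end Maximizer

/-! ### Riesz functionals, moment matrices and localizing matrices -/

section Moments

variable {n : ℕ}

/-- The Riesz functional as a linear map. -/
noncomputable def rieszLinear {k : ℕ} (y : MultiIndex n k → ℝ) :
    MvPolynomial (Fin n) ℝ →ₗ[ℝ] ℝ where
  toFun := rieszFunctional y
  map_add' f h := by
    simp [rieszFunctional, add_mul, Finset.sum_add_distrib]
  map_smul' c f := by
    simp [rieszFunctional, Finset.mul_sum, mul_assoc]

theorem rieszLinear_apply {k : ℕ} (y : MultiIndex n k → ℝ) (f : MvPolynomial (Fin n) ℝ) :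
    rieszLinear y f = rieszFunctional y f := rfl

theorem rieszFunctional_monomial {k : ℕ} (y : MultiIndex n k → ℝ) (α : Fin n →₀ ℕ)
    (hα : α.degree ≤ k) : rieszFunctional y (MvPolynomial.monomial α 1) = y ⟨α, hα⟩ := by
  rw [rieszFunctional, Finset.sum_eq_single ⟨α, hα⟩]
  · simp
  · intro β _ hβ
    have : α ≠ β.1 := fun h => hβ (Subtype.ext h.symm)
    simp [MvPolynomial.coeff_monomial, this]
  · simp

/-- The polynomial `∑_α c_α x^α` of degree at most `l` with coefficient vector `c`. -/
noncomputable def polyOfVec {l : ℕ} (c : MultiIndex n l → ℝ) : MvPolynomial (Fin n) ℝ :=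
  ∑ α, c α • MvPolynomial.monomial α.1 1

theorem totalDegree_polyOfVec_le {l : ℕ} (c : MultiIndex n l → ℝ) :
    (polyOfVec c).totalDegree ≤ l := by
  refine MvPolynomial.totalDegree_finsetSum_le fun α _ => ?_
  refine (MvPolynomial.totalDegree_smul_le _ _).trans
    ((MvPolynomial.totalDegree_monomial_le _ _).trans ?_)
  exact α.2

theorem coeff_polyOfVec {l : ℕ} (c : MultiIndex n l → ℝ) (α : MultiIndex n l) :
    (polyOfVec c).coeff α.1 = c α := by
  rw [polyOfVec, MvPolynomial.coeff_sum, Finset.sum_eq_single α]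
  · simp
  · intro β _ hβ
    have : β.1 ≠ α.1 := fun h => hβ (Subtype.ext h)
    simp [MvPolynomial.coeff_monomial, this]
  · simp

theorem ext_of_totalDegree_le {l : ℕ} {f h : MvPolynomial (Fin n) ℝ} (hf : f.totalDegree ≤ l)
    (hh : h.totalDegree ≤ l) (hfh : ∀ α : MultiIndex n l, f.coeff α.1 = h.coeff α.1) : f = h := by
  ext α
  by_cases hα : α.degree ≤ l
  · exact hfh ⟨α, hα⟩
  · have key : ∀ p : MvPolynomial (Fin n) ℝ, p.totalDegree ≤ l → p.coeff α = 0 := by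
      intro p hp
      apply MvPolynomial.coeff_eq_zero_of_totalDegree_lt
      have : α.degree = ∑ i ∈ α.support, α i := rfl
      omega
    rw [key f hf, key h hh]

theorem polyOfVec_coeff {l : ℕ} {f : MvPolynomial (Fin n) ℝ} (hf : f.totalDegree ≤ l) :
    polyOfVec (fun α : MultiIndex n l => f.coeff α.1) = f :=
  ext_of_totalDegree_le (totalDegree_polyOfVec_le _) hf fun α => coeff_polyOfVec _ α

theorem polyOfVec_eq_zero_iff {l : ℕ} {c : MultiIndex n l → ℝ} : polyOfVec c = 0 ↔ c = 0 := by
  refine ⟨fun h => funext fun α => ?_, fun h => by simp [h, polyOfVec]⟩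
  rw [← coeff_polyOfVec c α, h]
  simp

theorem rieszFunctional_eq_of_restrict {k l : ℕ} (hkl : k ≤ l) {y : MultiIndex n k → ℝ}
    {z : MultiIndex n l → ℝ} (hyz : ∀ α : MultiIndex n k, y α = z ⟨α.1, α.2.trans hkl⟩)
    {f : MvPolynomial (Fin n) ℝ} (hf : f.totalDegree ≤ k) :
    rieszFunctional y f = rieszFunctional z f := by
  rw [← polyOfVec_coeff hf, polyOfVec, ← rieszLinear_apply, ← rieszLinear_apply, map_sum, map_sum]
  refine Finset.sum_congr rfl fun α _ => ?_
  rw [map_smul, map_smul, rieszLinear_apply, rieszLinear_apply,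
    rieszFunctional_monomial y _ α.2, rieszFunctional_monomial z _ (α.2.trans hkl), hyz]

theorem localizingMatrix_isHermitian {k : ℕ} (l : ℕ) (f : MvPolynomial (Fin n) ℝ)
    (z : MultiIndex n k → ℝ) : (localizingMatrix l f z).IsHermitian := by
  ext α β
  simp [localizingMatrix, add_comm]

/-- The quadratic form of a localizing matrix is `c ↦ L_z(f h²)`, where `h = ∑ c_α x^α`. -/
theorem dotProduct_localizingMatrix {k : ℕ} (l : ℕ) (f : MvPolynomial (Fin n) ℝ)
    (z : MultiIndex n k → ℝ) (c : MultiIndex n l → ℝ) :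
    c ⬝ᵥ (localizingMatrix l f z *ᵥ c) = rieszFunctional z (f * polyOfVec c ^ 2) := by
  rw [← rieszLinear_apply, polyOfVec, sq, Finset.sum_mul_sum, Finset.mul_sum, map_sum, dotProduct]
  refine Finset.sum_congr rfl fun α _ => ?_
  rw [Matrix.mulVec, dotProduct, Finset.mul_sum, Finset.mul_sum, map_sum]
  refine Finset.sum_congr rfl fun β _ => ?_
  rw [smul_mul_smul_comm, mul_smul_comm, map_smul, rieszLinear_apply]
  simp only [localizingMatrix, Matrix.of_apply, smul_eq_mul]
  ring

theorem localizingMatrix_posSemidef_iff {k : ℕ} (l : ℕ) (f : MvPolynomial (Fin n) ℝ)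
    (z : MultiIndex n k → ℝ) : (localizingMatrix l f z).PosSemidef ↔
      ∀ h : MvPolynomial (Fin n) ℝ, h.totalDegree ≤ l → 0 ≤ rieszFunctional z (f * h ^ 2) := by
  rw [Matrix.posSemidef_iff_dotProduct_mulVec]
  constructor
  · rintro ⟨-, h⟩ p hp
    have := h (fun α => p.coeff α.1)
    rwa [star_trivial, dotProduct_localizingMatrix, polyOfVec_coeff hp] at this
  · refine fun h => ⟨localizingMatrix_isHermitian l f z, fun c => ?_⟩
    rw [star_trivial, dotProduct_localizingMatrix]
    exact h _ (totalDegree_polyOfVec_le c)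

theorem momentMatrix_eq_localizingMatrix {k : ℕ} (z : MultiIndex n (2 * k) → ℝ) :
    momentMatrix z = localizingMatrix k 1 z := by
  ext α β
  have hα := α.2
  have hβ := β.2
  simp only [momentMatrix, localizingMatrix, Matrix.of_apply, one_mul, MvPolynomial.monomial_mul]
  rw [rieszFunctional_monomial z (α.1 + β.1) (by rw [map_add]; omega)]

theorem momentMatrix_posSemidef_iff {k : ℕ} (z : MultiIndex n (2 * k) → ℝ) :
    (momentMatrix z).PosSemidef ↔
      ∀ h : MvPolynomial (Fin n) ℝ, h.totalDegree ≤ k → 0 ≤ rieszFunctional z (h ^ 2) := by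
  simp [momentMatrix_eq_localizingMatrix, localizingMatrix_posSemidef_iff]

/-- The moment matrix as a linear map of the sequence. -/
noncomputable def momentLinear (n k : ℕ) :
    (MultiIndex n (2 * k) → ℝ) →ₗ[ℝ] Matrix (MultiIndex n k) (MultiIndex n k) ℝ where
  toFun := momentMatrix
  map_add' y z := by ext; simp [momentMatrix]
  map_smul' c y := by ext; simp [momentMatrix]

/-- The extended moment sequences `z` in the definition of `relaxedMomentCone`. -/
def extendedMomentCone {m : ℕ} (g : Fin m → MvPolynomial (Fin n) ℝ) (k : ℕ) :
    Set (MultiIndex n (2 * k) → ℝ) :=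
  {z | (momentMatrix z).PosSemidef ∧ ∀ j, halfDegree (g j) ≤ k →
    (localizingMatrix (k - halfDegree (g j)) (g j) z).PosSemidef}

theorem sumsOfSquares_induction {k : ℕ} {L : MvPolynomial (Fin n) ℝ →ₗ[ℝ] ℝ}
    {f σ : MvPolynomial (Fin n) ℝ} (hσ : σ ∈ sumsOfSquares n k)
    (hL : ∀ h : MvPolynomial (Fin n) ℝ, h.totalDegree ≤ k → 0 ≤ L (f * h ^ 2)) :
    0 ≤ L (f * σ) := by
  obtain ⟨N, h, hh, rfl⟩ := hσ
  rw [Finset.mul_sum, map_sum]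
  exact Finset.sum_nonneg fun i _ => hL _ (hh i)

/-- A member of the truncated quadratic module is nonnegative under every linear functional that is
nonnegative on its generators. -/
theorem nonneg_of_mem_truncatedQuadraticModule {m : ℕ} {g : Fin m → MvPolynomial (Fin n) ℝ}
    {d δ : ℕ} {p : MvPolynomial (Fin n) ℝ} (hp : p ∈ truncatedQuadraticModule g d δ)
    (L : MvPolynomial (Fin n) ℝ →ₗ[ℝ] ℝ)
    (hL : ∀ h : MvPolynomial (Fin n) ℝ, h.totalDegree ≤ d + δ → 0 ≤ L (h ^ 2))
    (hLg : ∀ j, halfDegree (g j) ≤ d + δ → ∀ h : MvPolynomial (Fin n) ℝ,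
      h.totalDegree ≤ d + δ - halfDegree (g j) → 0 ≤ L (g j * h ^ 2)) : 0 ≤ L p := by
  obtain ⟨-, σ₀, hσ₀, σ, hσ, hσ', rfl⟩ := hp
  rw [map_add, map_sum]
  refine add_nonneg ?_ (Finset.sum_nonneg fun j _ => ?_)
  · have := sumsOfSquares_induction (L := L) (f := 1) hσ₀ (by simpa using hL)
    simpa using this
  · by_cases hj : halfDegree (g j) ≤ d + δ
    · exact sumsOfSquares_induction (hσ j hj) (hLg j hj)
    · rw [hσ' j (by omega)]
      simp

theorem rieszFunctional_nonneg_of_mem {m : ℕ} {g : Fin m → MvPolynomial (Fin n) ℝ}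
    {d δ : ℕ} {p : MvPolynomial (Fin n) ℝ} (hp : p ∈ truncatedQuadraticModule g d δ)
    {y : MultiIndex n (2 * d) → ℝ} (hy : y ∈ relaxedMomentCone g d δ) :
    0 ≤ rieszFunctional y p := by
  obtain ⟨z, hyz, hz, hzg⟩ := hy
  rw [rieszFunctional_eq_of_restrict (by omega) hyz hp.1]
  exact nonneg_of_mem_truncatedQuadraticModule hp (rieszLinear z)
    ((momentMatrix_posSemidef_iff z).1 hz)
    fun j hj => (localizingMatrix_posSemidef_iff _ _ z).1 (hzg j hj)

theorem eval_nonneg_of_mem {m : ℕ} {g : Fin m → MvPolynomial (Fin n) ℝ}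
    {d δ : ℕ} {p : MvPolynomial (Fin n) ℝ} (hp : p ∈ truncatedQuadraticModule g d δ)
    {x : Fin n → ℝ} (hx : x ∈ semialgebraicSet g) : 0 ≤ MvPolynomial.eval x p := by
  have h := nonneg_of_mem_truncatedQuadraticModule hp (MvPolynomial.aeval x).toLinearMap
    (fun h _ => by simpa using sq_nonneg (MvPolynomial.aeval x h))
    (fun j _ h _ => by
      have := hx j
      simp only [AlgHom.toLinearMap_apply, map_mul, map_pow, MvPolynomial.aeval_eq_eval]
      exact mul_nonneg this (sq_nonneg _))
  simpa [MvPolynomial.aeval_eq_eval] using h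

theorem totalDegree_monomialVector_mul_le {d : ℕ} (c : ℝ) (α β : MultiIndex n d) :
    (MvPolynomial.monomial α.1 1 * (MvPolynomial.C c * MvPolynomial.monomial β.1 1) :
      MvPolynomial (Fin n) ℝ).totalDegree ≤ 2 * d := by
  have hα : α.1.degree ≤ d := α.2
  have hβ : β.1.degree ≤ d := β.2
  rw [MvPolynomial.C_mul_monomial, MvPolynomial.monomial_mul]
  refine (MvPolynomial.totalDegree_monomial_le _ _).trans ?_
  change (α.1 + β.1).degree ≤ _
  rw [map_add]
  omega

theorem christoffelPolynomial_eq_sum {d : ℕ} (q : ℝ) (y : MultiIndex n (2 * d) → ℝ) :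
    christoffelPolynomial q y = ∑ α : MultiIndex n d, ∑ β : MultiIndex n d,
      MvPolynomial.monomial α.1 1 * (MvPolynomial.C (matrixPow (momentMatrix y) (q - 1) α β)
        * MvPolynomial.monomial β.1 1) := by
  simp only [christoffelPolynomial, dotProduct, Matrix.mulVec, monomialVector, Matrix.map_apply,
    Finset.mul_sum]

theorem totalDegree_dualPolynomial_le {d : ℕ} (q : ℝ) (y : MultiIndex n (2 * d) → ℝ) :
    (dualPolynomial q y).totalDegree ≤ 2 * d := by
  refine (MvPolynomial.totalDegree_sub _ _).trans (max_le (by simp) ?_)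
  rw [christoffelPolynomial_eq_sum]
  exact MvPolynomial.totalDegree_finsetSum_le fun α _ =>
    MvPolynomial.totalDegree_finsetSum_le fun β _ => totalDegree_monomialVector_mul_le _ α β

theorem rieszFunctional_dualPolynomial {d : ℕ} (q : ℝ) (y z : MultiIndex n (2 * d) → ℝ) :
    rieszFunctional z (dualPolynomial q y)
      = (matrixPow (momentMatrix y) q).trace * z ⟨0, by simp⟩
        - (matrixPow (momentMatrix y) (q - 1) * momentMatrix z).trace := by
  rw [← rieszLinear_apply, dualPolynomial, map_sub, christoffelPolynomial_eq_sum]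
  congr 1
  · have : (MvPolynomial.C (matrixPow (momentMatrix y) q).trace : MvPolynomial (Fin n) ℝ)
        = (matrixPow (momentMatrix y) q).trace • MvPolynomial.monomial 0 1 := by
      rw [MvPolynomial.smul_monomial, smul_eq_mul, mul_one]; rfl
    rw [this, map_smul, rieszLinear_apply, rieszFunctional_monomial z 0 (by simp), smul_eq_mul]
  · rw [map_sum, Matrix.trace]
    refine Finset.sum_congr rfl fun α _ => ?_
    rw [map_sum, Matrix.diag_apply, Matrix.mul_apply]
    refine Finset.sum_congr rfl fun β _ => ?_
    have hα : α.1.degree ≤ d := α.2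
    have hβ : β.1.degree ≤ d := β.2
    have : (MvPolynomial.monomial α.1 1 * (MvPolynomial.C (matrixPow (momentMatrix y) (q - 1) α β)
        * MvPolynomial.monomial β.1 1) : MvPolynomial (Fin n) ℝ)
        = matrixPow (momentMatrix y) (q - 1) α β • MvPolynomial.monomial (β.1 + α.1) 1 := by
      rw [MvPolynomial.C_mul_monomial, MvPolynomial.monomial_mul, MvPolynomial.smul_monomial,
        add_comm]
      simp
    rw [this, map_smul, rieszLinear_apply,
      rieszFunctional_monomial z (β.1 + α.1) (by rw [map_add]; omega)]
    rfl

end Moments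

/-! ### Bounds on moments and compactness of the feasible set -/

section Compactness

variable {n m : ℕ}

theorem exists_eq_add_single {α : Fin n →₀ ℕ} (hα : α ≠ 0) :
    ∃ β i, α = β + Finsupp.single i 1 ∧ α.degree = β.degree + 1 := by
  obtain ⟨i, hi⟩ := Finsupp.ne_iff.1 hα
  have h : α = (α - Finsupp.single i 1) + Finsupp.single i 1 := by
    rw [tsub_add_cancel_of_le]
    rw [Finsupp.single_le_iff]
    exact Nat.one_le_iff_ne_zero.2 hi
  refine ⟨_, i, h, ?_⟩
  conv_lhs => rw [h]
  rw [map_add, Finsupp.degree_single]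

theorem exists_eq_add_of_degree_le (a b : ℕ) (γ : Fin n →₀ ℕ) (hγ : γ.degree ≤ a + b) :
    ∃ α β, γ = α + β ∧ α.degree ≤ a ∧ β.degree ≤ b := by
  induction a generalizing γ with
  | zero => exact ⟨0, γ, by simp, by simp, by omega⟩
  | succ a ih =>
    rcases eq_or_ne γ 0 with rfl | h0
    · exact ⟨0, 0, by simp, by simp, by simp⟩
    · obtain ⟨β, i, rfl, hdeg⟩ := exists_eq_add_single h0
      obtain ⟨α, β, rfl, h1, h2⟩ := ih β (by omega)
      refine ⟨α + Finsupp.single i 1, β, by abel, ?_, h2⟩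
      rw [map_add, Finsupp.degree_single]
      omega

theorem momentMatrix_injective {k : ℕ} :
    Function.Injective (momentMatrix : (MultiIndex n (2 * k) → ℝ) → _) := by
  intro y z h
  ext γ
  obtain ⟨α, β, hγ, hα, hβ⟩ := exists_eq_add_of_degree_le k k γ.1 (by have := γ.2; omega)
  have := congrFun (congrFun h ⟨α, hα⟩) ⟨β, hβ⟩
  simp only [momentMatrix, Matrix.of_apply] at this
  have hγ' : γ = ⟨α + β, hγ ▸ γ.2⟩ := Subtype.ext hγ
  rw [hγ']
  exact this

/-- Positive semidefiniteness of the localizing matrix of the ball constraint bounds the even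
moments `z_{2α}`, one degree at a time. -/
theorem rieszFunctional_monomial_sq_le {k : ℕ} {g : Fin m → MvPolynomial (Fin n) ℝ}
    {j₀ : Fin m} {R : ℝ}
    (hj₀ : g j₀ = MvPolynomial.C (R ^ 2) - ∑ i, (MvPolynomial.X i : MvPolynomial (Fin n) ℝ) ^ 2)
    {z : MultiIndex n (2 * k) → ℝ} (hz : z ∈ extendedMomentCone g k) (N : ℕ) (hN : N ≤ k)
    (α : Fin n →₀ ℕ) (hα : α.degree = N) :
    rieszFunctional z (MvPolynomial.monomial α 1 ^ 2)
      ≤ (R ^ 2) ^ N * z ⟨0, by simp⟩ := by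
  induction N generalizing α with
  | zero =>
    rw [Finsupp.degree_eq_zero_iff] at hα
    subst hα
    rw [MvPolynomial.monomial_pow, smul_zero, one_pow, rieszFunctional_monomial z 0 (by simp)]
    simp
  | succ N ih =>
    have hne : α ≠ 0 := by rintro rfl; simp at hα
    obtain ⟨β, i, rfl, hdeg⟩ := exists_eq_add_single hne
    have hβ : β.degree = N := by omega
    have hdeg2 : (g j₀).totalDegree ≤ 2 := by
      rw [hj₀]
      refine (MvPolynomial.totalDegree_sub _ _).trans
        (max_le (by rw [MvPolynomial.totalDegree_C]; omega) ?_)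
      refine MvPolynomial.totalDegree_finsetSum_le fun i _ => ?_
      exact (MvPolynomial.totalDegree_pow _ _).trans (by simp)
    have hhalf : halfDegree (g j₀) ≤ 1 := by unfold halfDegree; omega
    have hmβ : (MvPolynomial.monomial β (1 : ℝ)).totalDegree ≤ N :=
      (MvPolynomial.totalDegree_monomial_le _ _).trans hβ.le
    have hloc := (localizingMatrix_posSemidef_iff _ _ z).1 (hz.2 j₀ (by omega))
      (MvPolynomial.monomial β 1) (hmβ.trans (by omega))
    have hsq := (momentMatrix_posSemidef_iff z).1 hz.1
    have hnn : ∀ i, 0 ≤ rieszLinear z ((MvPolynomial.X i * MvPolynomial.monomial β 1) ^ 2) :=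
      fun i => hsq _ ((MvPolynomial.totalDegree_mul _ _).trans (by
        rw [MvPolynomial.totalDegree_X]; omega))
    have hexp : g j₀ * MvPolynomial.monomial β 1 ^ 2
        = R ^ 2 • MvPolynomial.monomial β 1 ^ 2
          - ∑ i, (MvPolynomial.X i * MvPolynomial.monomial β 1) ^ 2 := by
      rw [hj₀, sub_mul, Finset.sum_mul, MvPolynomial.smul_eq_C_mul]
      simp only [mul_pow]
    rw [hexp, ← rieszLinear_apply, map_sub, map_smul, map_sum, sub_nonneg, smul_eq_mul] at hloc
    have h1 := Finset.single_le_sum (fun i _ => hnn i) (Finset.mem_univ i)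
    have h2 : (MvPolynomial.monomial (β + Finsupp.single i 1) 1 : MvPolynomial (Fin n) ℝ)
        = MvPolynomial.X i * MvPolynomial.monomial β 1 := by
      rw [MvPolynomial.X, MvPolynomial.monomial_mul, add_comm, one_mul]
    rw [h2, ← rieszLinear_apply]
    refine (h1.trans hloc).trans ?_
    rw [pow_succ' (R ^ 2), mul_assoc]
    exact mul_le_mul_of_nonneg_left (ih (by omega) β hβ) (sq_nonneg R)

theorem abs_le_of_mem_extendedMomentCone {k : ℕ} {g : Fin m → MvPolynomial (Fin n) ℝ}
    {j₀ : Fin m} {R : ℝ}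
    (hj₀ : g j₀ = MvPolynomial.C (R ^ 2) - ∑ i, (MvPolynomial.X i : MvPolynomial (Fin n) ℝ) ^ 2)
    {z : MultiIndex n (2 * k) → ℝ} (hz : z ∈ extendedMomentCone g k)
    (γ : MultiIndex n (2 * k)) : |z γ| ≤ (max 1 (R ^ 2)) ^ k * z ⟨0, by simp⟩ := by
  have hsq := (momentMatrix_posSemidef_iff z).1 hz.1
  have h0 : 0 ≤ z ⟨0, by simp⟩ := by
    have := hsq 1 (by simp)
    rw [one_pow, ← MvPolynomial.C_1, MvPolynomial.C_apply,
      rieszFunctional_monomial z 0 (by simp)] at this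
    exact this
  have hdiag : ∀ α : Fin n →₀ ℕ, α.degree ≤ k →
      rieszLinear z (MvPolynomial.monomial α 1 ^ 2)
        ≤ (max 1 (R ^ 2)) ^ k * z ⟨0, by simp⟩ := by
    intro α hα
    refine (rieszFunctional_monomial_sq_le hj₀ hz _ hα α rfl).trans
      (mul_le_mul_of_nonneg_right ?_ h0)
    exact (pow_le_pow_left₀ (sq_nonneg R) (le_max_right _ _) _).trans
      (pow_le_pow_right₀ (le_max_left _ _) hα)
  obtain ⟨α, β, hγ, hα, hβ⟩ := exists_eq_add_of_degree_le k k γ.1 (by have := γ.2; omega)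
  have hz' : z γ = rieszLinear z (MvPolynomial.monomial α 1 * MvPolynomial.monomial β 1) := by
    rw [MvPolynomial.monomial_mul, one_mul, ← hγ, rieszLinear_apply,
      rieszFunctional_monomial z γ.1 γ.2]
  have hmα : (MvPolynomial.monomial α (1 : ℝ)).totalDegree ≤ k :=
    (MvPolynomial.totalDegree_monomial_le _ _).trans hα
  have hmβ : (MvPolynomial.monomial β (1 : ℝ)).totalDegree ≤ k :=
    (MvPolynomial.totalDegree_monomial_le _ _).trans hβ
  have h1 := hsq (MvPolynomial.monomial α 1 + MvPolynomial.monomial β 1)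
    ((MvPolynomial.totalDegree_add _ _).trans (max_le hmα hmβ))
  have h2 := hsq (MvPolynomial.monomial α 1 - MvPolynomial.monomial β 1)
    ((MvPolynomial.totalDegree_sub _ _).trans (max_le hmα hmβ))
  have e1 : (MvPolynomial.monomial α 1 + MvPolynomial.monomial β 1 : MvPolynomial (Fin n) ℝ) ^ 2
      = MvPolynomial.monomial α 1 ^ 2 + MvPolynomial.monomial β 1 ^ 2
        + (2 : ℝ) • (MvPolynomial.monomial α 1 * MvPolynomial.monomial β 1) := by
    rw [MvPolynomial.smul_eq_C_mul]; simp only [map_ofNat]; ring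
  have e2 : (MvPolynomial.monomial α 1 - MvPolynomial.monomial β 1 : MvPolynomial (Fin n) ℝ) ^ 2
      = MvPolynomial.monomial α 1 ^ 2 + MvPolynomial.monomial β 1 ^ 2
        - (2 : ℝ) • (MvPolynomial.monomial α 1 * MvPolynomial.monomial β 1) := by
    rw [MvPolynomial.smul_eq_C_mul]; simp only [map_ofNat]; ring
  rw [e1, ← rieszLinear_apply, map_add, map_add, map_smul, smul_eq_mul, ← hz'] at h1
  rw [e2, ← rieszLinear_apply, map_sub, map_add, map_smul, smul_eq_mul, ← hz'] at h2
  rw [abs_le]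
  constructor <;> linarith [hdiag α hα, hdiag β hβ]

/-- Truncation of moment sequences. -/
noncomputable def truncate (n : ℕ) {k l : ℕ} (h : k ≤ l) :
    (MultiIndex n l → ℝ) →ₗ[ℝ] (MultiIndex n k → ℝ) :=
  LinearMap.funLeft ℝ ℝ fun α => ⟨α.1, α.2.trans h⟩

theorem rieszFunctional_truncate {k l : ℕ} (h : k ≤ l) (z : MultiIndex n l → ℝ)
    {f : MvPolynomial (Fin n) ℝ} (hf : f.totalDegree ≤ k) :
    rieszFunctional (truncate n h z) f = rieszFunctional z f :=
  rieszFunctional_eq_of_restrict h (y := truncate n h z) (z := z) (fun _ => rfl) hf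

theorem mem_relaxedMomentCone_iff {g : Fin m → MvPolynomial (Fin n) ℝ} {d δ : ℕ}
    {y : MultiIndex n (2 * d) → ℝ} : y ∈ relaxedMomentCone g d δ ↔
      ∃ z ∈ extendedMomentCone g (d + δ), truncate n (by omega) z = y := by
  constructor
  · rintro ⟨z, h1, h2, h3⟩
    exact ⟨z, ⟨h2, h3⟩, funext fun α => (h1 α).symm⟩
  · rintro ⟨z, ⟨h2, h3⟩, rfl⟩
    exact ⟨z, fun α => rfl, h2, h3⟩

theorem feasibleSet_eq_image (g : Fin m → MvPolynomial (Fin n) ℝ) (d δ : ℕ) :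
    feasibleSet g d δ = truncate n (by omega : 2 * d ≤ 2 * (d + δ)) ''
      (extendedMomentCone g (d + δ) ∩ {z | z ⟨0, by simp⟩ = 1}) := by
  ext y
  constructor
  · rintro ⟨hy, hy0⟩
    obtain ⟨z, hz, rfl⟩ := mem_relaxedMomentCone_iff.1 hy
    exact ⟨z, ⟨hz, hy0⟩, rfl⟩
  · rintro ⟨z, ⟨hz, hz0⟩, rfl⟩
    exact ⟨mem_relaxedMomentCone_iff.2 ⟨z, hz, rfl⟩, hz0⟩

theorem continuous_rieszFunctional {k : ℕ} (f : MvPolynomial (Fin n) ℝ) :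
    Continuous fun z : MultiIndex n k → ℝ => rieszFunctional z f := by
  unfold rieszFunctional
  fun_prop

theorem rieszFunctional_add_smul {k : ℕ} (a b : ℝ) (y z : MultiIndex n k → ℝ)
    (f : MvPolynomial (Fin n) ℝ) : rieszFunctional (a • y + b • z) f
      = a * rieszFunctional y f + b * rieszFunctional z f := by
  simp only [rieszFunctional, Finset.mul_sum, ← Finset.sum_add_distrib]
  refine Finset.sum_congr rfl fun α _ => ?_
  simp only [Pi.add_apply, Pi.smul_apply, smul_eq_mul]
  ring

theorem mem_extendedMomentCone_iff {k : ℕ} {g : Fin m → MvPolynomial (Fin n) ℝ}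
    {z : MultiIndex n (2 * k) → ℝ} : z ∈ extendedMomentCone g k ↔
      (∀ h : MvPolynomial (Fin n) ℝ, h.totalDegree ≤ k → 0 ≤ rieszFunctional z (h ^ 2)) ∧
      ∀ j, halfDegree (g j) ≤ k → ∀ h : MvPolynomial (Fin n) ℝ,
        h.totalDegree ≤ k - halfDegree (g j) → 0 ≤ rieszFunctional z (g j * h ^ 2) := by
  simp only [extendedMomentCone, Set.mem_ofPred_eq, momentMatrix_posSemidef_iff,
    localizingMatrix_posSemidef_iff]

theorem isClosed_extendedMomentCone (g : Fin m → MvPolynomial (Fin n) ℝ) (k : ℕ) :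
    IsClosed (extendedMomentCone g k) := by
  have : extendedMomentCone g k = {z | (∀ h : MvPolynomial (Fin n) ℝ, h.totalDegree ≤ k →
      0 ≤ rieszFunctional z (h ^ 2)) ∧
      ∀ j, halfDegree (g j) ≤ k → ∀ h : MvPolynomial (Fin n) ℝ,
        h.totalDegree ≤ k - halfDegree (g j) → 0 ≤ rieszFunctional z (g j * h ^ 2)} :=
    Set.ext fun z => mem_extendedMomentCone_iff
  rw [this]
  simp only [Set.ofPred_and, Set.ofPred_forall]
  refine .inter ?_ ?_
  · exact isClosed_iInter fun h => isClosed_iInter fun _ =>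
      isClosed_le continuous_const (continuous_rieszFunctional _)
  · exact isClosed_iInter fun j => isClosed_iInter fun _ => isClosed_iInter fun h =>
      isClosed_iInter fun _ => isClosed_le continuous_const (continuous_rieszFunctional _)

theorem add_smul_mem_extendedMomentCone {k : ℕ} {g : Fin m → MvPolynomial (Fin n) ℝ} {a b : ℝ}
    (ha : 0 ≤ a) (hb : 0 ≤ b) {y z : MultiIndex n (2 * k) → ℝ} (hy : y ∈ extendedMomentCone g k)
    (hz : z ∈ extendedMomentCone g k) : a • y + b • z ∈ extendedMomentCone g k := by
  rw [mem_extendedMomentCone_iff] at hy hz ⊢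
  simp only [rieszFunctional_add_smul]
  exact ⟨fun h hh => add_nonneg (mul_nonneg ha (hy.1 h hh)) (mul_nonneg hb (hz.1 h hh)),
    fun j hj h hh => add_nonneg (mul_nonneg ha (hy.2 j hj h hh)) (mul_nonneg hb (hz.2 j hj h hh))⟩

theorem convex_feasibleSet (g : Fin m → MvPolynomial (Fin n) ℝ) (d δ : ℕ) :
    Convex ℝ (feasibleSet g d δ) := by
  rw [feasibleSet_eq_image]
  refine Convex.linear_image ?_ _
  intro y hy z hz a b ha hb hab
  refine ⟨add_smul_mem_extendedMomentCone ha hb hy.1 hz.1, ?_⟩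
  have h1 : y ⟨0, by simp⟩ = 1 := hy.2
  have h2 : z ⟨0, by simp⟩ = 1 := hz.2
  simp [h1, h2, hab]

theorem isCompact_feasibleSet {g : Fin m → MvPolynomial (Fin n) ℝ}
    (hball : ∃ (j : Fin m) (R : ℝ),
      g j = MvPolynomial.C (R ^ 2) - ∑ i, (MvPolynomial.X i : MvPolynomial (Fin n) ℝ) ^ 2)
    (d δ : ℕ) : IsCompact (feasibleSet g d δ) := by
  obtain ⟨j₀, R, hj₀⟩ := hball
  rw [feasibleSet_eq_image]
  refine IsCompact.image ?_ (LinearMap.continuous_of_finiteDimensional _)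
  refine Metric.isCompact_of_isClosed_isBounded ?_ ?_
  · exact (isClosed_extendedMomentCone g _).inter
      (isClosed_eq (continuous_apply _) continuous_const)
  · refine (Metric.isBounded_closedBall (x := 0) (r := (max 1 (R ^ 2)) ^ (d + δ))).subset ?_
    rintro z ⟨hz, hz0⟩
    rw [mem_closedBall_zero_iff, pi_norm_le_iff_of_nonneg (by positivity)]
    intro γ
    have h := abs_le_of_mem_extendedMomentCone hj₀ hz γ
    have h0 : z ⟨0, by simp⟩ = 1 := hz0
    rwa [h0, mul_one] at h

theorem posSemidef_momentMatrix_of_mem {g : Fin m → MvPolynomial (Fin n) ℝ} {d δ : ℕ}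
    {y : MultiIndex n (2 * d) → ℝ} (hy : y ∈ relaxedMomentCone g d δ) :
    (momentMatrix y).PosSemidef := by
  obtain ⟨z, hyz, hz, -⟩ := hy
  rw [momentMatrix_posSemidef_iff] at hz ⊢
  intro h hh
  rw [rieszFunctional_eq_of_restrict (by omega) hyz
    ((MvPolynomial.totalDegree_pow _ _).trans (by omega))]
  exact hz h (by omega)

end Compactness

/-! ### A feasible point with positive definite moment matrix -/

section Slater

variable {n m : ℕ}

theorem exists_box_subset {g : Fin m → MvPolynomial (Fin n) ℝ}
    (hint : (interior (semialgebraicSet g)).Nonempty) :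
    ∃ s : Fin n → Set ℝ, (∀ i, (s i).Infinite) ∧
      Set.univ.pi s ⊆ semialgebraicSet g := by
  obtain ⟨x, hx⟩ := hint
  obtain ⟨ε, hε, hball⟩ := Metric.isOpen_iff.1 isOpen_interior x hx
  refine ⟨fun i => Metric.ball (x i) ε, fun i => ?_, ?_⟩
  · beta_reduce
    rw [Real.ball_eq_Ioo]
    exact Set.Ioo_infinite (by linarith)
  · rw [← ball_pi x hε]
    exact hball.trans interior_subset

/-- The moments of the uniform distribution on a sufficiently fine grid inside `X`. -/
theorem exists_mem_feasibleSet_posDef {g : Fin m → MvPolynomial (Fin n) ℝ}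
    (hint : (interior (semialgebraicSet g)).Nonempty) (d δ : ℕ) :
    ∃ y ∈ feasibleSet g d δ, (momentMatrix y).PosDef := by
  classical
  obtain ⟨s, hs, hsub⟩ := exists_box_subset hint
  choose S hSs hScard using fun i => (hs i).exists_subset_card_eq (d + 1)
  set G := Fintype.piFinset S
  have hGX : ∀ x ∈ G, x ∈ semialgebraicSet g := fun x hx =>
    hsub fun i _ => hSs i (Fintype.mem_piFinset.1 hx i)
  have hGne : G.Nonempty := Fintype.piFinset_nonempty.2 fun i => by
    rw [← Finset.card_pos, hScard]; omega
  have hGcard : (0 : ℝ) < G.card := by exact_mod_cast hGne.card_pos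
  let z : ∀ {k : ℕ}, MultiIndex n k → ℝ := fun {k} α =>
    (G.card : ℝ)⁻¹ * ∑ x ∈ G, MvPolynomial.eval x (MvPolynomial.monomial α.1 1)
  have hz : ∀ (k : ℕ) (f : MvPolynomial (Fin n) ℝ), f.totalDegree ≤ k →
      rieszFunctional (z (k := k)) f = (G.card : ℝ)⁻¹ * ∑ x ∈ G, MvPolynomial.eval x f := by
    intro k f hf
    conv_rhs => rw [← polyOfVec_coeff hf, polyOfVec]
    simp only [rieszFunctional, z, map_sum, MvPolynomial.smul_eval]
    rw [Finset.sum_comm, Finset.mul_sum]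
    refine Finset.sum_congr rfl fun α _ => ?_
    rw [← Finset.mul_sum]
    ring
  refine ⟨z, ⟨mem_relaxedMomentCone_iff.2 ⟨z, mem_extendedMomentCone_iff.2 ⟨?_, ?_⟩, rfl⟩, ?_⟩, ?_⟩
  · intro h hh
    rw [hz _ _ ((MvPolynomial.totalDegree_pow _ _).trans (by omega))]
    exact mul_nonneg (by positivity) (Finset.sum_nonneg fun x _ => by
      rw [map_pow]; exact sq_nonneg _)
  · intro j hj h hh
    rw [hz _ _ ((MvPolynomial.totalDegree_mul _ _).trans (by
      have := MvPolynomial.totalDegree_pow h 2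
      unfold halfDegree at hj hh
      omega))]
    exact mul_nonneg (by positivity) (Finset.sum_nonneg fun x hx => by
      rw [map_mul, map_pow]; exact mul_nonneg (hGX x hx j) (sq_nonneg _))
  · simp only [z]
    rw [show (MvPolynomial.monomial (0 : Fin n →₀ ℕ) (1 : ℝ)) = 1 from rfl]
    simp only [map_one, Finset.sum_const, nsmul_eq_mul, mul_one]
    exact inv_mul_cancel₀ hGcard.ne'
  · rw [momentMatrix_eq_localizingMatrix]
    refine .of_dotProduct_mulVec_pos (localizingMatrix_isHermitian _ _ _) fun c hc => ?_
    have hdeg := totalDegree_polyOfVec_le c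
    rw [star_trivial, dotProduct_localizingMatrix, one_mul,
      hz _ _ ((MvPolynomial.totalDegree_pow _ _).trans (by omega))]
    have hnn : ∀ x ∈ G, 0 ≤ MvPolynomial.eval x (polyOfVec c ^ 2) := fun x _ => by
      rw [map_pow]; exact sq_nonneg _
    refine mul_pos (inv_pos.2 hGcard) ((Finset.sum_nonneg hnn).lt_of_ne' fun h0 => hc ?_)
    rw [← polyOfVec_eq_zero_iff]
    refine MvPolynomial.eq_zero_of_eval_zero_at_prod_finset _ S (fun i => ?_) fun x hx => ?_
    · rw [hScard]
      have := MvPolynomial.degreeOf_le_totalDegree (polyOfVec c) i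
      omega
    · have := (Finset.sum_eq_zero_iff_of_nonneg hnn).1 h0 x (Fintype.mem_piFinset.2 hx)
      rw [map_pow] at this
      exact pow_eq_zero_iff (two_ne_zero) |>.1 this

end Slater

/-! ### Duality between the moment cone and the truncated quadratic module -/

/-- A linear image of a closed cone is closed if the cone meets the kernel only in `0`. -/
theorem isClosed_map_of_ker_inter_eq_zero {E V : Type*} [NormedAddCommGroup E] [NormedSpace ℝ E]
    [FiniteDimensional ℝ E] [NormedAddCommGroup V] [NormedSpace ℝ V] (T : E →L[ℝ] V)
    (K : PointedCone ℝ E) (hK : IsClosed (K : Set E)) (h : ∀ x ∈ K, T x = 0 → x = 0) :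
    IsClosed (T '' K) := by
  have : ProperSpace E := FiniteDimensional.proper ℝ E
  obtain ⟨c, hc, hT⟩ : ∃ c : ℝ, 0 < c ∧ ∀ x ∈ K, c * ‖x‖ ≤ ‖T x‖ := by
    rcases (Metric.sphere (0 : E) 1 ∩ K).eq_empty_or_nonempty with hS | hS
    · refine ⟨1, one_pos, fun x hx => ?_⟩
      rcases eq_or_ne x 0 with rfl | hx0
      · simp
      · have : ‖x‖⁻¹ • x ∈ Metric.sphere (0 : E) 1 ∩ K :=
          ⟨by simp [norm_smul, hx0], K.smul_mem (inv_nonneg.2 (norm_nonneg x)) hx⟩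
        rw [hS] at this
        exact this.elim
    · obtain ⟨x₀, hx₀, hmin⟩ := ((isCompact_sphere (0 : E) 1).inter_right hK).exists_isMinOn hS
        (T.continuous.norm.continuousOn)
      refine ⟨‖T x₀‖, norm_pos_iff.2 fun h0 => ?_, fun x hx => ?_⟩
      · have := h x₀ hx₀.2 h0
        have h1 := hx₀.1
        simp [this] at h1
      · rcases eq_or_ne x 0 with rfl | hx0
        · simp
        · have hx' : ‖x‖⁻¹ • x ∈ Metric.sphere (0 : E) 1 ∩ K :=
            ⟨by simp [norm_smul, hx0], K.smul_mem (inv_nonneg.2 (norm_nonneg x)) hx⟩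
          have h2 : ‖T x₀‖ ≤ ‖T (‖x‖⁻¹ • x)‖ := hmin hx'
          rw [map_smul, norm_smul, norm_inv, norm_norm, inv_mul_eq_div,
            le_div_iff₀ (norm_pos_iff.2 hx0)] at h2
          exact h2
  rw [← isSeqClosed_iff_isClosed]
  intro u v hu huv
  choose x hxK hxu using hu
  obtain ⟨r, hr⟩ := huv.norm.bddAbove_range
  have hbd : ∀ k, x k ∈ Metric.closedBall (0 : E) (r / c) ∩ K := fun k => by
    refine ⟨?_, hxK k⟩
    rw [mem_closedBall_zero_iff, le_div_iff₀ hc, mul_comm]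
    refine (hT _ (hxK k)).trans ?_
    rw [hxu]
    exact hr ⟨k, rfl⟩
  obtain ⟨a, ha, φ, hφ, hlim⟩ :=
    ((isCompact_closedBall (0 : E) (r / c)).inter_right hK).tendsto_subseq hbd
  refine ⟨a, ha.2, tendsto_nhds_unique ((T.continuous.tendsto a).comp hlim) ?_⟩
  have : (T ∘ x ∘ φ) = u ∘ φ := funext fun k => hxu _
  rw [this]
  exact huv.comp hφ.tendsto_atTop

section Gram

variable {n : ℕ}

/-- The polynomial `v_l(x)ᵀ Q v_l(x)` with Gram matrix `Q`, as a linear map of `Q`. Plain functions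
instead of matrices carry the sup norm. -/
noncomputable def gram (n l : ℕ) :
    (MultiIndex n l → MultiIndex n l → ℝ) →ₗ[ℝ] MvPolynomial (Fin n) ℝ where
  toFun Q := ∑ α, ∑ β, Q α β • (MvPolynomial.monomial α.1 1 * MvPolynomial.monomial β.1 1)
  map_add' Q P := by simp only [Pi.add_apply, add_smul, Finset.sum_add_distrib]
  map_smul' c Q := by
    simp only [Pi.smul_apply, smul_eq_mul, mul_smul, Finset.smul_sum, RingHom.id_apply]

theorem gram_mul_self {l : ℕ} (c : MultiIndex n l → ℝ) :
    gram n l (fun α β => c α * c β) = polyOfVec c ^ 2 := by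
  rw [polyOfVec, sq, Finset.sum_mul_sum]
  refine Finset.sum_congr rfl fun α _ => Finset.sum_congr rfl fun β _ => ?_
  rw [smul_mul_smul_comm]

theorem exists_eq_sum_mul_self {l : ℕ} {Q : MultiIndex n l → MultiIndex n l → ℝ}
    (hQ : (Matrix.of Q).PosSemidef) : ∃ (N : ℕ) (v : Fin N → MultiIndex n l → ℝ),
      Q = ∑ i, (fun α β => v i α * v i β) ∧ gram n l Q = ∑ i, polyOfVec (v i) ^ 2 := by
  obtain ⟨N, v, hv⟩ := Matrix.posSemidef_iff_eq_sum_vecMulVec.1 hQ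
  have hQ' : Q = ∑ i, (fun α β => v i α * v i β) := hv
  refine ⟨N, v, hQ', ?_⟩
  rw [hQ', map_sum]
  exact Finset.sum_congr rfl fun i _ => gram_mul_self _

theorem gram_mem_sumsOfSquares {l : ℕ} {Q : MultiIndex n l → MultiIndex n l → ℝ}
    (hQ : (Matrix.of Q).PosSemidef) : gram n l Q ∈ sumsOfSquares n l := by
  obtain ⟨N, v, -, h⟩ := exists_eq_sum_mul_self hQ
  exact ⟨N, fun i => polyOfVec (v i), fun i => totalDegree_polyOfVec_le _, h⟩

theorem eval_gram_nonneg {l : ℕ} {Q : MultiIndex n l → MultiIndex n l → ℝ}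
    (hQ : (Matrix.of Q).PosSemidef) (x : Fin n → ℝ) :
    0 ≤ MvPolynomial.eval x (gram n l Q) := by
  obtain ⟨N, v, -, h⟩ := exists_eq_sum_mul_self hQ
  rw [h, map_sum]
  exact Finset.sum_nonneg fun i _ => by rw [map_pow]; exact sq_nonneg _

theorem eq_zero_of_gram_eq_zero {l : ℕ} {Q : MultiIndex n l → MultiIndex n l → ℝ}
    (hQ : (Matrix.of Q).PosSemidef) (h0 : gram n l Q = 0) : Q = 0 := by
  obtain ⟨N, v, hQv, h⟩ := exists_eq_sum_mul_self hQ
  have hv : ∀ i, v i = 0 := by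
    intro i
    rw [← polyOfVec_eq_zero_iff]
    refine MvPolynomial.funext fun x => ?_
    have h1 : ∑ i, MvPolynomial.eval x (polyOfVec (v i)) ^ 2 = 0 := by
      have := congrArg (MvPolynomial.eval x) (h.symm.trans h0)
      simpa using this
    have h2 := (Finset.sum_eq_zero_iff_of_nonneg fun i _ => sq_nonneg _).1 h1 i
      (Finset.mem_univ i)
    rw [map_zero]
    exact pow_eq_zero_iff two_ne_zero |>.1 h2
  rw [hQv]
  refine Finset.sum_eq_zero fun i _ => ?_
  ext α β
  simp [hv i]

theorem totalDegree_gram_le {l : ℕ} {Q : MultiIndex n l → MultiIndex n l → ℝ} :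
    (gram n l Q).totalDegree ≤ 2 * l := by
  refine MvPolynomial.totalDegree_finsetSum_le fun α _ =>
    MvPolynomial.totalDegree_finsetSum_le fun β _ => ?_
  refine (MvPolynomial.totalDegree_smul_le _ _).trans ?_
  have := totalDegree_monomialVector_mul_le 1 α β
  rwa [MvPolynomial.C_1, one_mul] at this

end Gram

section Farkas

variable {n : ℕ} {J : Type}

/-- Families of positive semidefinite Gram matrices. -/
def gramCone (n : ℕ) (l : J → ℕ) :
    PointedCone ℝ (∀ j, MultiIndex n (l j) → MultiIndex n (l j) → ℝ) where
  carrier := {Q | ∀ j, (Matrix.of (Q j)).PosSemidef}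
  add_mem' hQ hP j := (hQ j).add (hP j)
  zero_mem' _ := Matrix.PosSemidef.zero
  smul_mem' c _ hQ j := (hQ j).smul c.2

theorem isClosed_gramCone (l : J → ℕ) :
    IsClosed (gramCone n l : Set (∀ j, MultiIndex n (l j) → MultiIndex n (l j) → ℝ)) := by
  have : (gramCone n l : Set (∀ j, MultiIndex n (l j) → MultiIndex n (l j) → ℝ)) =
      {Q | ∀ j, (∀ α β, Q j β α = Q j α β) ∧
        ∀ x : MultiIndex n (l j) → ℝ, 0 ≤ ∑ α, x α * ∑ β, Q j α β * x β} := by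
    ext Q
    refine forall_congr' fun j => ?_
    rw [Matrix.posSemidef_iff_dotProduct_mulVec, Matrix.IsHermitian, ← Matrix.ext_iff]
    rfl
  rw [this]
  simp only [Set.ofPred_forall, Set.ofPred_and]
  refine isClosed_iInter fun j => .inter ?_ ?_
  · exact isClosed_iInter fun α => isClosed_iInter fun β =>
      isClosed_eq (by fun_prop) (by fun_prop)
  · exact isClosed_iInter fun x => isClosed_le continuous_const (by fun_prop)

variable [Fintype J]

/-- The polynomial `∑_j G_j v(x)ᵀ Q_j v(x)`. -/
noncomputable def weightedGram (l : J → ℕ) (G : J → MvPolynomial (Fin n) ℝ) :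
    (∀ j, MultiIndex n (l j) → MultiIndex n (l j) → ℝ) →ₗ[ℝ] MvPolynomial (Fin n) ℝ :=
  ∑ j, LinearMap.mulLeft ℝ (G j) ∘ₗ gram n (l j) ∘ₗ LinearMap.proj j

theorem weightedGram_apply (l : J → ℕ) (G : J → MvPolynomial (Fin n) ℝ)
    (Q : ∀ j, MultiIndex n (l j) → MultiIndex n (l j) → ℝ) :
    weightedGram l G Q = ∑ j, G j * gram n (l j) (Q j) := by
  simp [weightedGram]

/-- The vector of coefficients of degree at most `k`. -/
noncomputable def coeffVec (n k : ℕ) : MvPolynomial (Fin n) ℝ →ₗ[ℝ] (MultiIndex n k → ℝ) :=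
  LinearMap.pi fun α => MvPolynomial.lcoeff ℝ α.1

theorem totalDegree_weightedGram_le {l : J → ℕ} {G : J → MvPolynomial (Fin n) ℝ} {k : ℕ}
    (hdeg : ∀ j, (G j).totalDegree + 2 * l j ≤ 2 * k)
    (Q : ∀ j, MultiIndex n (l j) → MultiIndex n (l j) → ℝ) :
    (weightedGram l G Q).totalDegree ≤ 2 * k := by
  rw [weightedGram_apply]
  refine MvPolynomial.totalDegree_finsetSum_le fun j _ =>
    (MvPolynomial.totalDegree_mul _ _).trans ?_
  have := totalDegree_gram_le (Q := Q j)
  have := hdeg j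
  omega

/-- No cancellation occurs in `∑_j G_j v(x)ᵀ Q_j v(x)`, since every summand is nonnegative on a
nonempty open box. -/
theorem eq_zero_of_weightedGram_eq_zero {l : J → ℕ} {G : J → MvPolynomial (Fin n) ℝ}
    (hG : ∀ j, G j ≠ 0) {s : Fin n → Set ℝ} (hs : ∀ i, (s i).Infinite)
    (hGs : ∀ x ∈ Set.univ.pi s, ∀ j, 0 ≤ MvPolynomial.eval x (G j))
    {Q : ∀ j, MultiIndex n (l j) → MultiIndex n (l j) → ℝ} (hQ : Q ∈ gramCone n l)
    (h0 : weightedGram l G Q = 0) : Q = 0 := by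
  funext j
  refine eq_zero_of_gram_eq_zero (hQ j) ((mul_eq_zero.1 ?_).resolve_left (hG j))
  refine MvPolynomial.funext_set s hs fun x hx => ?_
  have hnn : ∀ j ∈ Finset.univ, 0 ≤ MvPolynomial.eval x (G j * gram n (l j) (Q j)) := fun j _ => by
    rw [map_mul]
    exact mul_nonneg (hGs x hx j) (eval_gram_nonneg (hQ j) x)
  have hsum : ∑ j, MvPolynomial.eval x (G j * gram n (l j) (Q j)) = 0 := by
    rw [← map_sum, ← weightedGram_apply, h0, map_zero]
  rw [map_zero]
  exact (Finset.sum_eq_zero_iff_of_nonneg hnn).1 hsum j (Finset.mem_univ j)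

/-- Farkas' lemma for weighted sums of squares. -/
theorem exists_weightedGram_eq {l : J → ℕ} {G : J → MvPolynomial (Fin n) ℝ} {k : ℕ}
    (hdeg : ∀ j, (G j).totalDegree + 2 * l j ≤ 2 * k)
    (hG : ∀ j, G j ≠ 0) {s : Fin n → Set ℝ} (hs : ∀ i, (s i).Infinite)
    (hGs : ∀ x ∈ Set.univ.pi s, ∀ j, 0 ≤ MvPolynomial.eval x (G j))
    {p : MvPolynomial (Fin n) ℝ} (hp : p.totalDegree ≤ 2 * k)
    (hpos : ∀ z : MultiIndex n (2 * k) → ℝ,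
      (∀ j, ∀ h : MvPolynomial (Fin n) ℝ, h.totalDegree ≤ l j →
        0 ≤ rieszFunctional z (G j * h ^ 2)) → 0 ≤ rieszFunctional z p) :
    ∃ Q ∈ gramCone n l, p = weightedGram l G Q := by
  classical
  set T := LinearMap.toContinuousLinearMap (coeffVec n (2 * k) ∘ₗ weightedGram l G)
  have hT : ∀ Q, T Q = coeffVec n (2 * k) (weightedGram l G Q) := fun Q => rfl
  have hinj : ∀ {f h : MvPolynomial (Fin n) ℝ}, f.totalDegree ≤ 2 * k → h.totalDegree ≤ 2 * k →
      coeffVec n (2 * k) f = coeffVec n (2 * k) h → f = h := fun hf hh hfh =>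
    ext_of_totalDegree_le hf hh fun α => congrFun hfh α
  have hclosed : IsClosed (T '' (gramCone n l)) :=
    isClosed_map_of_ker_inter_eq_zero T _ (isClosed_gramCone l) fun Q hQ hTQ =>
      eq_zero_of_weightedGram_eq_zero hG hs hGs hQ
        (hinj (totalDegree_weightedGram_le hdeg Q) (by simp) (by rw [map_zero, ← hTQ, hT]))
  let C : ProperCone ℝ (MultiIndex n (2 * k) → ℝ) :=
    { PointedCone.map (coeffVec n (2 * k) ∘ₗ weightedGram l G) (gramCone n l) with
      isClosed' := hclosed }
  have hC : ∀ c, c ∈ C ↔ ∃ Q ∈ gramCone n l, T Q = c := fun c => Iff.rfl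
  by_cases hmem : coeffVec n (2 * k) p ∈ C
  · obtain ⟨Q, hQ, hTQ⟩ := (hC _).1 hmem
    exact ⟨Q, hQ, hinj hp (totalDegree_weightedGram_le hdeg Q) hTQ.symm⟩
  · exfalso
    obtain ⟨φ, hφ, hφp⟩ := C.hyperplane_separation_point hmem
    -- The separating functional is the Riesz functional of a sequence `z`.
    set z : MultiIndex n (2 * k) → ℝ := fun α => φ (Pi.single α 1)
    have hφz : ∀ f, φ (coeffVec n (2 * k) f) = rieszFunctional z f := by
      intro f
      conv_lhs => rw [← Finset.univ_sum_single (coeffVec n (2 * k) f)]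
      rw [map_sum, rieszFunctional]
      refine Finset.sum_congr rfl fun α _ => ?_
      have : Pi.single α (coeffVec n (2 * k) f α)
          = f.coeff α.1 • (Pi.single α 1 : MultiIndex n (2 * k) → ℝ) := by
        rw [← Pi.single_smul, smul_eq_mul, mul_one]; rfl
      rw [this, map_smul, smul_eq_mul]
    rw [hφz] at hφp
    refine absurd (hpos z fun j h hh => ?_) (not_le.2 hφp)
    set c : MultiIndex n (l j) → ℝ := fun α => h.coeff α.1
    set Q : ∀ j, MultiIndex n (l j) → MultiIndex n (l j) → ℝ :=
      Pi.single j fun α β => c α * c β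
    have hQ : Q ∈ gramCone n l := by
      intro i
      rcases eq_or_ne i j with rfl | hij
      · have hi : Matrix.of (Q i) = Matrix.vecMulVec c (star c) := by
          simp only [Q, Pi.single_eq_same]; rfl
        rw [hi]
        exact Matrix.posSemidef_vecMulVec_self_star c
      · simp only [Q, Pi.single_eq_of_ne hij]
        exact Matrix.PosSemidef.zero
    have hW : weightedGram l G Q = G j * h ^ 2 := by
      rw [weightedGram_apply, Finset.sum_eq_single j]
      · simp only [Q, Pi.single_eq_same, gram_mul_self]
        rw [polyOfVec_coeff hh]
      · intro i _ hij
        simp only [Q, Pi.single_eq_of_ne hij, map_zero, mul_zero]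
      · simp
    rw [← hφz, ← hW]
    exact hφ _ ((hC _).2 ⟨Q, hQ, rfl⟩)

/-- The truncated quadratic module contains the dual of the relaxed moment cone. -/
theorem mem_truncatedQuadraticModule_of_forall {m : ℕ} {g : Fin m → MvPolynomial (Fin n) ℝ}
    (hint : (interior (semialgebraicSet g)).Nonempty) {d δ : ℕ} {p : MvPolynomial (Fin n) ℝ}
    (hp : p.totalDegree ≤ 2 * d)
    (hpos : ∀ y ∈ relaxedMomentCone g d δ, 0 ≤ rieszFunctional y p) :
    p ∈ truncatedQuadraticModule g d δ := by
  classical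
  obtain ⟨s, hs, hsub⟩ := exists_box_subset hint
  -- The weights are `1` and the nonzero `g j` that occur; a zero `g j` would spoil injectivity.
  let S : Type := {j : Fin m // halfDegree (g j) ≤ d + δ ∧ g j ≠ 0}
  let G : Option S → MvPolynomial (Fin n) ℝ := fun o => o.elim 1 fun j => g j.1
  let l : Option S → ℕ := fun o => o.elim (d + δ) fun j => d + δ - halfDegree (g j.1)
  obtain ⟨Q, hQ, hpQ⟩ := exists_weightedGram_eq (l := l) (G := G) (k := d + δ) (p := p)
    (by
      rintro (_ | j)
      · simp [G, l]
      · have h1 := j.2.1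
        simp only [G, l, Option.elim_some]
        unfold halfDegree at h1 ⊢
        omega)
    (by
      rintro (_ | j)
      · simp [G]
      · exact j.2.2) hs
    (by
      rintro x hx (_ | j)
      · simp [G]
      · exact hsub hx j.1)
    (by omega)
    (fun z hz => by
      have hzK : z ∈ extendedMomentCone g (d + δ) := by
        refine mem_extendedMomentCone_iff.2 ⟨fun h hh => ?_, fun j hj h hh => ?_⟩
        · simpa [G] using hz none h hh
        · by_cases hg : g j = 0
          · rw [hg, zero_mul, ← rieszLinear_apply, map_zero]
          · exact hz (some ⟨j, hj, hg⟩) h hh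
      have h1 := hpos _ (mem_relaxedMomentCone_iff.2 ⟨z, hzK, rfl⟩)
      rwa [rieszFunctional_truncate _ z hp] at h1)
  refine ⟨hp, gram n _ (Q none), gram_mem_sumsOfSquares (hQ none),
    fun j => if h : halfDegree (g j) ≤ d + δ ∧ g j ≠ 0 then gram n _ (Q (some ⟨j, h⟩)) else 0,
    fun j hj => ?_, fun j hj => ?_, ?_⟩
  · beta_reduce
    split_ifs with h
    · exact gram_mem_sumsOfSquares (hQ (some ⟨j, h⟩))
    · exact ⟨0, Fin.elim0, fun i => i.elim0, by simp⟩
  · exact dif_neg fun h => by omega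
  · rw [hpQ, weightedGram_apply, Fintype.sum_option]
    congr 1
    · simp [G, l]
    · rw [← Finset.sum_subset (Finset.subset_univ
        (Finset.univ.filter fun j => halfDegree (g j) ≤ d + δ ∧ g j ≠ 0))]
      · rw [Finset.sum_subtype (p := fun j => halfDegree (g j) ≤ d + δ ∧ g j ≠ 0) _ (by simp)]
        refine Finset.sum_congr rfl fun j _ => ?_
        beta_reduce
        rw [dif_pos j.2]
        rfl
      · intro j _ hj
        rw [Finset.mem_filter, not_and] at hj
        beta_reduce
        rw [dif_neg (hj (Finset.mem_univ j)), mul_zero]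

end Farkas

/-! ### Optimal solutions -/

section Optimal

variable {n m : ℕ}

instance (n k : ℕ) : Nonempty (MultiIndex n k) := ⟨⟨0, by simp⟩⟩

/-- Sufficiency of the dual certificate, with uniqueness. -/
theorem isOptimalSolution_of_dualPolynomial_mem {d δ : ℕ} {q : ℝ} (hq : q < 1)
    {g : Fin m → MvPolynomial (Fin n) ℝ} {y : MultiIndex n (2 * d) → ℝ}
    (hy : y ∈ feasibleSet g d δ) (hpd : (momentMatrix y).PosDef)
    (hp : dualPolynomial q y ∈ truncatedQuadraticModule g d δ) :
    IsOptimalSolution q g d δ y ∧ ∀ z, IsOptimalSolution q g d δ z → z = y := by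
  have key : ∀ z ∈ feasibleSet g d δ,
      kieferCriterion q (momentMatrix z) ≤ kieferCriterion q (momentMatrix y) ∧
      (kieferCriterion q (momentMatrix y) ≤ kieferCriterion q (momentMatrix z) →
        momentMatrix z = momentMatrix y) := by
    intro z hz
    refine kieferCriterion_le_of_trace_le hq hpd (posSemidef_momentMatrix_of_mem hz.1) ?_
    have h := rieszFunctional_nonneg_of_mem hp hz.1
    rwa [rieszFunctional_dualPolynomial, hz.2, mul_one, sub_nonneg] at h
  exact ⟨⟨hy, fun z hz => (key z hz).1⟩, fun z hz =>
    momentMatrix_injective ((key z hz.1).2 (hz.2 y hy))⟩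

/-- A sequence in the relaxed moment cone is a nonnegative multiple of a feasible one: the ball
constraint forces it to vanish if `y_0 = 0`. -/
theorem exists_smul_of_mem_relaxedMomentCone {g : Fin m → MvPolynomial (Fin n) ℝ}
    (hball : ∃ (j : Fin m) (R : ℝ),
      g j = MvPolynomial.C (R ^ 2) - ∑ i, (MvPolynomial.X i : MvPolynomial (Fin n) ℝ) ^ 2)
    {d δ : ℕ} {y : MultiIndex n (2 * d) → ℝ} (hy : y ∈ relaxedMomentCone g d δ) :
    y = 0 ∨ ∃ c : ℝ, 0 < c ∧ ∃ w ∈ feasibleSet g d δ, y = c • w := by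
  obtain ⟨j₀, R, hj₀⟩ := hball
  obtain ⟨z, hz, rfl⟩ := mem_relaxedMomentCone_iff.1 hy
  have hb := abs_le_of_mem_extendedMomentCone hj₀ hz
  have h0 : 0 ≤ z ⟨0, by simp⟩ := by
    have h1 := (abs_nonneg _).trans (hb ⟨0, by simp⟩)
    exact nonneg_of_mul_nonneg_right h1 (by positivity)
  rcases h0.eq_or_lt with h0 | h0
  · left
    have : z = 0 := funext fun γ => by
      have := hb γ
      rw [← h0, mul_zero] at this
      exact abs_nonpos_iff.1 this
    rw [this, map_zero]
  · right
    refine ⟨z ⟨0, by simp⟩, h0, (z ⟨0, by simp⟩)⁻¹ • truncate n (by omega) z,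
      ⟨mem_relaxedMomentCone_iff.2 ⟨(z ⟨0, by simp⟩)⁻¹ • z, ?_, map_smul _ _ _⟩, ?_⟩, ?_⟩
    · have := add_smul_mem_extendedMomentCone (inv_nonneg.2 h0.le) le_rfl hz hz
      rwa [zero_smul, add_zero] at this
    · exact inv_mul_cancel₀ h0.ne'
    · rw [smul_inv_smul₀ h0.ne']

/-- A feasible sequence that satisfies the first-order condition has a dual certificate. -/
theorem dualPolynomial_mem_of_forall_trace_le {d δ : ℕ} {q : ℝ}
    {g : Fin m → MvPolynomial (Fin n) ℝ}
    (hball : ∃ (j : Fin m) (R : ℝ),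
      g j = MvPolynomial.C (R ^ 2) - ∑ i, (MvPolynomial.X i : MvPolynomial (Fin n) ℝ) ^ 2)
    (hint : (interior (semialgebraicSet g)).Nonempty) {y : MultiIndex n (2 * d) → ℝ}
    (h : ∀ z ∈ feasibleSet g d δ, (matrixPow (momentMatrix y) (q - 1) * momentMatrix z).trace
      ≤ (matrixPow (momentMatrix y) q).trace) :
    dualPolynomial q y ∈ truncatedQuadraticModule g d δ := by
  refine mem_truncatedQuadraticModule_of_forall hint (totalDegree_dualPolynomial_le q y)
    fun z hz => ?_
  rcases exists_smul_of_mem_relaxedMomentCone hball hz with rfl | ⟨c, hc, w, hw, rfl⟩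
  · simp [rieszFunctional]
  · have h1 : 0 ≤ rieszFunctional w (dualPolynomial q y) := by
      rw [rieszFunctional_dualPolynomial, hw.2, mul_one, sub_nonneg]
      exact h w hw
    have h2 := rieszFunctional_add_smul c 0 w w (dualPolynomial q y)
    rw [zero_smul, add_zero, zero_mul, add_zero] at h2
    rw [h2]
    exact mul_nonneg hc.le h1

/-- Existence of a feasible sequence with positive definite moment matrix and dual certificate. -/
theorem exists_dualPolynomial_mem {d δ : ℕ} {q : ℝ} (hq : q < 1)
    {g : Fin m → MvPolynomial (Fin n) ℝ}
    (hball : ∃ (j : Fin m) (R : ℝ),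
      g j = MvPolynomial.C (R ^ 2) - ∑ i, (MvPolynomial.X i : MvPolynomial (Fin n) ℝ) ^ 2)
    (hint : (interior (semialgebraicSet g)).Nonempty) :
    ∃ y ∈ feasibleSet g d δ, (momentMatrix y).PosDef ∧
      dualPolynomial q y ∈ truncatedQuadraticModule g d δ := by
  obtain ⟨y₀, hy₀, hpd₀⟩ := exists_mem_feasibleSet_posDef hint d δ
  have hcont : Continuous (momentLinear n d) := LinearMap.continuous_of_finiteDimensional _
  obtain ⟨_, ⟨y, hy, rfl⟩, hpd, h⟩ := exists_posDef_forall_trace_le hq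
    ((isCompact_feasibleSet hball d δ).image hcont)
    ((convex_feasibleSet g d δ).linear_image (momentLinear n d))
    (by rintro _ ⟨z, hz, rfl⟩; exact posSemidef_momentMatrix_of_mem hz.1)
    ⟨y₀, hy₀, rfl⟩ hpd₀
  exact ⟨y, hy, hpd, dualPolynomial_mem_of_forall_trace_le hball hint fun z hz =>
    h _ ⟨z, hz, rfl⟩⟩

end Optimal
end OptDesign

theorem theorem2 {n m : ℕ} (d δ : ℕ) (q : ℝ) (hq : q < 1)
    (g : Fin m → MvPolynomial (Fin n) ℝ)
    (hball : ∃ (j : Fin m) (R : ℝ),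
      g j = MvPolynomial.C (R ^ 2) - ∑ i, (MvPolynomial.X i : MvPolynomial (Fin n) ℝ) ^ 2)
    (hint : (interior (OptDesign.semialgebraicSet g)).Nonempty) :
    (∃! y : OptDesign.MultiIndex n (2 * d) → ℝ, OptDesign.IsOptimalSolution q g d δ y) ∧
    (∀ y : OptDesign.MultiIndex n (2 * d) → ℝ, OptDesign.IsOptimalSolution q g d δ y →
      (OptDesign.momentMatrix y).PosDef ∧
      OptDesign.dualPolynomial q y ∈ OptDesign.truncatedQuadraticModule g d δ ∧
      (∀ x ∈ OptDesign.semialgebraicSet g,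
        0 ≤ MvPolynomial.eval x (OptDesign.dualPolynomial q y)) ∧
      OptDesign.rieszFunctional y (OptDesign.dualPolynomial q y) = 0) ∧
    (∀ y : OptDesign.MultiIndex n (2 * d) → ℝ,
      (OptDesign.IsOptimalSolution q g d δ y ∧
        ∀ z, OptDesign.IsOptimalSolution q g d δ z → z = y) ↔
      (y ∈ OptDesign.feasibleSet g d δ ∧ (OptDesign.momentMatrix y).PosDef ∧
        OptDesign.dualPolynomial q y ∈ OptDesign.truncatedQuadraticModule g d δ)) := by
  obtain ⟨y₀, hy₀, hpd₀, hp₀⟩ := OptDesign.exists_dualPolynomial_mem (d := d) (δ := δ) hq hball hint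
  obtain ⟨hopt, huniq⟩ := OptDesign.isOptimalSolution_of_dualPolynomial_mem hq hy₀ hpd₀ hp₀
  refine ⟨⟨y₀, hopt, huniq⟩, fun y hy => ?_, fun y => ⟨fun hy => ?_, fun hy => ?_⟩⟩
  · obtain rfl := huniq y hy
    refine ⟨hpd₀, hp₀, fun x hx => OptDesign.eval_nonneg_of_mem hp₀ hx, ?_⟩
    rw [OptDesign.rieszFunctional_dualPolynomial, hy₀.2, mul_one,
      OptDesign.trace_matrixPow_mul_self hpd₀, sub_self]
  · obtain rfl := huniq y hy.1
    exact ⟨hy₀, hpd₀, hp₀⟩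
  · exact OptDesign.isOptimalSolution_of_dualPolynomial_mem hq hy.1 hy.2.1 hy.2.2
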